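/- Let $C_1>0$ and $L\in\mathbb N$. There is a constant $K_1$, depending only on $C_1$ and $L$, such that the following holds. Let $0\le m\le 1$ and $\omega\ge 0$, and let $A:\mathbb R\to\mathbb R$ satisfy condition $\mathcal A(m,\omega,C_1)$, that is: for a standard Gaussian $y$, the expectations $E\exp mA(x+y\sqrt w)$ and $EA(x+y\sqrt w)$ exist (are finite) for all $x\in\mathbb R$, $0\le w\le\omega$, and the function $$T(x,w)=\frac1m\log E\exp mA(x+y\sqrt w)$$ is four times differentiable in $x$ with $$\left|\frac{\partial T}{\partial x}\right|\le 1,\quad \frac1{C_1\cosh^2x}\le\frac{\partial^2T}{\partial x^2}\le\min\left(1,\frac{C_1}{\cosh^2x}\right),\quad \left|\frac{\partial^3T}{\partial x^3}\right|\le4,\quad \left|\frac{\partial^4T}{\partial x^4}\right|\le 8$$ for all $x\in\mathbb R$ and $0\le w\le\omega$. (Here and below, if $m=0$, an expression $\frac1m\log E\exp mX$ or $\frac{1+t}m\log E\exp\frac m{1+t}X$ is read as $EX$.) Let $y_1,y_2$ be jointly Gaussian centered random variables with $Ey_1^2=Ey_2^2=1$ and $Ey_1y_2=t\ge0$, and for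 $x_1,x_2\in\mathbb R$, $w\ge0$ put $$F(x_1,x_2,w)=E\bigl(\tanh(x_1+y_1\sqrt w)-\tanh(x_2+y_2\sqrt w)\bigr)^2 .$$ Let $K>0$, $\ell\ge0$ an integer, and $0\le\alpha_0,\dots,\alpha_\ell\le K$. Then there are constants $C_\ell^0,\dots,C_\ell^\ell>0$ with $$C_\ell^n\le 4\sum_{i=0}^\ell\alpha_i+K_1\qquad(0\le n\le\ell)$$ such that for all $x_1,x_2\in\mathbb R$, all $0\le w\le\min\left(\omega,\frac1{2C_\ell^0}\right)$, and all $w_0=0$, $0\le w_1,\dots,w_\ell\le L$, the random variable $$Z=A(x_1+y_1\sqrt w)+A(x_2+y_2\sqrt w)-\sum_{n=0}^\ell\alpha_nF(x_1+y_1\sqrt w,\,x_2+y_2\sqrt w,\,w_n)$$ (where $F(\cdot,\cdot,w_n)$ is the deterministic function above, evaluated at the random point) has $Z$ and $\exp\frac m{1+t}Z$ integrable, and $$\frac{1+t}m\log E\exp\frac m{1+t}Z\le\sum_{j=1}^2\frac1m\log E\exp mA(x_j+y_j\sqrt w)-\sum_{n=0}^\ell\left(\alpha_n(1-wC_\ell^n)+\frac{C_0}2mw\,\delta_0(n)\right)F\bigl(x_1,x_2,(1-\delta_0(n))w+w_n\bigr),$$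 where $C_0=\frac t{2(1+t)C_1^2}$, and $\delta_0(n)=1$ if $n=0$ and $\delta_0(n)=0$ otherwise. -/

import Mathlib

open MeasureTheory ProbabilityTheory

noncomputable section

/-- The normalized logarithmic moment `(1/a) log E exp (a X)` of a random variable `X`,
read as `E X` when `a = 0`. -/
def logExpMean {S : Type*} [MeasurableSpace S] (P : Measure S) (a : ℝ) (X : S → ℝ) : ℝ :=
  if a = 0 then ∫ s, X s ∂P
  else (1 / a) * Real.log (∫ s, Real.exp (a * X s) ∂P)

/-- `T(x, w) = (1/m) log E exp (m A(x + y √w))`, with `y` standard Gaussian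
(and `T(x, w) = E A(x + y √w)` when `m = 0`). -/
def smoothT (A : ℝ → ℝ) (m x w : ℝ) : ℝ :=
  logExpMean (gaussianReal 0 1) m (fun y => A (x + y * Real.sqrt w))

/-- Condition `𝒜(m, ω, C₁)` on a function `A : ℝ → ℝ`, the number `ω` being called `wmax`. -/
structure ConditionA (m wmax C₁ : ℝ) (A : ℝ → ℝ) : Prop where
  integrable_exp : ∀ x w : ℝ, 0 ≤ w → w ≤ wmax →
    Integrable (fun y => Real.exp (m * A (x + y * Real.sqrt w))) (gaussianReal 0 1)
  integrable : ∀ x w : ℝ, 0 ≤ w → w ≤ wmax →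
    Integrable (fun y => A (x + y * Real.sqrt w)) (gaussianReal 0 1)
  /-- `T(·, w)` is four times differentiable. -/
  differentiable : ∀ w : ℝ, 0 ≤ w → w ≤ wmax → ∀ k : ℕ, k < 4 →
    Differentiable ℝ (iteratedDeriv k (fun x => smoothT A m x w))
  deriv_one : ∀ x w : ℝ, 0 ≤ w → w ≤ wmax →
    |iteratedDeriv 1 (fun x => smoothT A m x w) x| ≤ 1
  deriv_two_lower : ∀ x w : ℝ, 0 ≤ w → w ≤ wmax →
    1 / (C₁ * Real.cosh x ^ 2) ≤ iteratedDeriv 2 (fun x => smoothT A m x w) x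
  deriv_two_upper : ∀ x w : ℝ, 0 ≤ w → w ≤ wmax →
    iteratedDeriv 2 (fun x => smoothT A m x w) x ≤ min 1 (C₁ / Real.cosh x ^ 2)
  deriv_three : ∀ x w : ℝ, 0 ≤ w → w ≤ wmax →
    |iteratedDeriv 3 (fun x => smoothT A m x w) x| ≤ 4
  deriv_four : ∀ x w : ℝ, 0 ≤ w → w ≤ wmax →
    |iteratedDeriv 4 (fun x => smoothT A m x w) x| ≤ 8

/-- `y₁, y₂` are jointly Gaussian and centered, with unit variances and `E y₁ y₂ = t`. -/
structure IsStdGaussianPair {S : Type*} [MeasurableSpace S] (P : Measure S)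
    (y₁ y₂ : S → ℝ) (t : ℝ) : Prop where
  gaussian : HasGaussianLaw (fun s => (y₁ s, y₂ s)) P
  mean_one : ∫ s, y₁ s ∂P = 0
  mean_two : ∫ s, y₂ s ∂P = 0
  var_one : ∫ s, y₁ s ^ 2 ∂P = 1
  var_two : ∫ s, y₂ s ^ 2 ∂P = 1
  corr : ∫ s, y₁ s * y₂ s ∂P = t

/-- `F(x₁, x₂, w) = E (tanh (x₁ + y₁ √w) - tanh (x₂ + y₂ √w))²`. -/
def tanhGap {S : Type*} [MeasurableSpace S] (P : Measure S) (y₁ y₂ : S → ℝ)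
    (x₁ x₂ w : ℝ) : ℝ :=
  ∫ s, (Real.tanh (x₁ + y₁ s * Real.sqrt w) - Real.tanh (x₂ + y₂ s * Real.sqrt w)) ^ 2 ∂P

/-- `δ₀(n)`: equal to `1` if `n = 0` and to `0` otherwise. -/
def deltaZero {l : ℕ} (n : Fin (l + 1)) : ℝ := if n = 0 then 1 else 0

/-- The random variable
`A(x₁ + y₁ √w) + A(x₂ + y₂ √w) - ∑ₙ αₙ F(x₁ + y₁ √w, x₂ + y₂ √w, wₙ)`. -/
def coupledValue {S : Type*} [MeasurableSpace S] (P : Measure S) (y₁ y₂ : S → ℝ)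
    (A : ℝ → ℝ) {l : ℕ} (α wseq : Fin (l + 1) → ℝ) (x₁ x₂ w : ℝ) (s : S) : ℝ :=
  A (x₁ + y₁ s * Real.sqrt w) + A (x₂ + y₂ s * Real.sqrt w)
    - ∑ n, α n * tanhGap P y₁ y₂ (x₁ + y₁ s * Real.sqrt w) (x₂ + y₂ s * Real.sqrt w) (wseq n)

end

/-! The proof interpolates in the variance. Put `U(x, s) = T(x₁, s) + T(x₂, s) - ∑ₙ bₙ(s) Fₙ(x, s)`,
with `bₙ(s) = αₙ(1 - sC) + κ s δ₀(n)` and `κ = C₀m/2`. Here `Fₙ` is the gap `(tanh x₁ - tanh x₂)²`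
smoothed for time `s + wₙ` when `n ≥ 1`, and left unsmoothed when `n = 0`. At `s = 0`, evaluated at
the random point, this is `Z`; at `s = w` it is the right-hand side. With `a = m/(1+t)` it suffices
that `U` be a supersolution of `∂ₛU = ½ΔU + ½a|∇U|²`, where `Δ` and `|·|²` are taken with the
covariance of `(y₁, y₂)`. Then `exp(aU)` is a supersolution of the linear heat equation and
dominates the Gaussian average of its initial value (`HasFlow.heat_le`, `HasFlow.logExpMean_le`).

The supersolution inequality (`supersolution_ineq`) rests on the following. Each `T` solves its own
equation `∂ₛT = ½(T'' + mT'²)` (`ConditionA.isLogHeatFlow`), and `Fₙ` solves the heat equation for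
`n ≥ 1`, so these second-order terms cancel; the frozen term `n = 0` costs at most a multiple of the
gap, because the gap satisfies `Δ gap ≥ -4 gap` (`gap_laplacian_ge`). With `aⱼ = T'(xⱼ)`, the
identity `a₁² + 2t a₁a₂ + a₂² = (1+t)(a₁² + a₂²) - t(a₁ - a₂)²` explains the exponent `m/(1+t)`: the
first part matches the equations for `T`, the second is a gain. As `T''` is comparable with `tanh'`,
the gain is at least a multiple of the gap, and this pays for `κ`.

What remains are terms involving `∇Fₙ`, to be absorbed by `C ∑ αₙFₙ`, which comes from the decay of
`1 - sC`. Terms quadratic in `∇Fₙ` are harmless since `|∇F|² ≲ F`. The cross term between `∇T` and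
`∇Fₙ` is only first order, but the derivative of `Fₙ` along the diagonal is `O(Fₙ)`, while the rest
carries the factor `a₁ - a₂`, which is `O(√gap)`. It is therefore `O(Fₙ)` as soon as the gap is
bounded by a constant times its smoothing (`gap_le_heat`); this is where the bound `L` on the `wₙ`
enters. -/

noncomputable section

/-! ### Exponential growth and Gaussian integrability -/

/-- A function on a normed space that grows at most exponentially. -/
def ExpGrowth {E : Type*} [NormedAddCommGroup E] (f : E → ℝ) : Prop :=
  ∃ B c : ℝ, 0 ≤ B ∧ 0 ≤ c ∧ ∀ x, |f x| ≤ B * Real.exp (c * ‖x‖)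

namespace ExpGrowth

variable {E : Type*} [NormedAddCommGroup E] {f g : E → ℝ}

lemma mono (hf : ExpGrowth f) (h : ∀ x, |g x| ≤ |f x|) : ExpGrowth g := by
  obtain ⟨B, c, hB, hc, H⟩ := hf
  exact ⟨B, c, hB, hc, fun x => (h x).trans (H x)⟩

lemma of_bounded (B : ℝ) (h : ∀ x, |f x| ≤ B) : ExpGrowth f :=
  ⟨B, 0, (abs_nonneg _).trans (h 0), le_rfl, fun x => by simpa using h x⟩

lemma const (a : ℝ) : ExpGrowth (fun _ : E => a) := of_bounded |a| fun _ => le_rfl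

lemma add (hf : ExpGrowth f) (hg : ExpGrowth g) : ExpGrowth (fun x => f x + g x) := by
  obtain ⟨B, c, hB, hc, H⟩ := hf
  obtain ⟨B', c', hB', hc', H'⟩ := hg
  refine ⟨B + B', c + c', by positivity, by positivity, fun x => ?_⟩
  have hx := norm_nonneg x
  have h1 : Real.exp (c * ‖x‖) ≤ Real.exp ((c + c') * ‖x‖) :=
    Real.exp_le_exp.2 (by nlinarith)
  have h2 : Real.exp (c' * ‖x‖) ≤ Real.exp ((c + c') * ‖x‖) :=
    Real.exp_le_exp.2 (by nlinarith)
  calc |f x + g x| ≤ |f x| + |g x| := abs_add_le _ _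
    _ ≤ B * Real.exp ((c + c') * ‖x‖) + B' * Real.exp ((c + c') * ‖x‖) := by
        gcongr
        · exact (H x).trans (by gcongr)
        · exact (H' x).trans (by gcongr)
    _ = _ := by ring

lemma mul (hf : ExpGrowth f) (hg : ExpGrowth g) : ExpGrowth (fun x => f x * g x) := by
  obtain ⟨B, c, hB, hc, H⟩ := hf
  obtain ⟨B', c', hB', hc', H'⟩ := hg
  refine ⟨B * B', c + c', by positivity, by positivity, fun x => ?_⟩
  rw [abs_mul, add_mul, Real.exp_add]
  calc |f x| * |g x| ≤ (B * Real.exp (c * ‖x‖)) * (B' * Real.exp (c' * ‖x‖)) := by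
        gcongr
        · exact H x
        · exact H' x
    _ = _ := by ring

lemma const_mul (a : ℝ) (hf : ExpGrowth f) : ExpGrowth (fun x => a * f x) := (const a).mul hf

lemma norm_id : ExpGrowth (fun x : E => ‖x‖) :=
  ⟨1, 1, zero_le_one, zero_le_one, fun x => by
    rw [abs_norm]; linarith [Real.add_one_le_exp (1 * ‖x‖)]⟩

lemma exp (hf : ∃ B c : ℝ, 0 ≤ c ∧ ∀ x, f x ≤ B + c * ‖x‖) :
    ExpGrowth (fun x => Real.exp (f x)) := by
  obtain ⟨B, c, hc, H⟩ := hf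
  refine ⟨Real.exp B, c, (Real.exp_pos _).le, hc, fun x => ?_⟩
  rw [abs_of_pos (Real.exp_pos _), ← Real.exp_add]
  exact Real.exp_le_exp.2 (H x)

lemma comp_of_norm_le {F : Type*} [NormedAddCommGroup F] (hf : ExpGrowth f) (φ : F → E)
    (a b : ℝ) (hb : 0 ≤ b) (h : ∀ x, ‖φ x‖ ≤ a + b * ‖x‖) : ExpGrowth (fun x => f (φ x)) := by
  obtain ⟨B, c, hB, hc, H⟩ := hf
  refine ⟨B * Real.exp (c * a), c * b, by positivity, by positivity, fun x => ?_⟩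
  refine (H _).trans ?_
  rw [mul_assoc, ← Real.exp_add]
  gcongr
  nlinarith [h x]

lemma comp_affine [NormedSpace ℝ E] (hf : ExpGrowth f) (x₀ : E) (r : ℝ) :
    ExpGrowth (fun x => f (x₀ + r • x)) :=
  hf.comp_of_norm_le _ ‖x₀‖ |r| (abs_nonneg _) fun x => by
    refine (norm_add_le _ _).trans ?_
    rw [norm_smul, Real.norm_eq_abs]

end ExpGrowth

lemma ExpGrowth.fst : ExpGrowth (fun p : ℝ × ℝ => p.1) :=
  ExpGrowth.norm_id.mono fun p => by rw [abs_norm]; exact norm_fst_le p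

lemma ExpGrowth.snd : ExpGrowth (fun p : ℝ × ℝ => p.2) :=
  ExpGrowth.norm_id.mono fun p => by rw [abs_norm]; exact norm_snd_le p

section Integrable

variable {E : Type*} [NormedAddCommGroup E] [NormedSpace ℝ E] [MeasurableSpace E] [BorelSpace E]
  [SecondCountableTopology E] [CompleteSpace E] {μ : Measure E} [IsGaussian μ]

/-- Fernique's theorem makes some `exp (C‖x‖²)` integrable; completing the square bounds `c‖x‖` by
`C‖x‖² + c²/(4C)`. -/
lemma integrable_exp_mul_norm_of_isGaussian (c : ℝ) :
    Integrable (fun x => Real.exp (c * ‖x‖)) μ := by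
  obtain ⟨C, hC, H⟩ := IsGaussian.exists_integrable_exp_sq μ
  refine (H.const_mul (Real.exp (c ^ 2 / (4 * C)))).mono' (by fun_prop) (ae_of_all _ fun x => ?_)
  rw [Real.norm_eq_abs, abs_of_pos (Real.exp_pos _), ← Real.exp_add]
  refine Real.exp_le_exp.2 ?_
  have : c ^ 2 / (4 * C) + C * ‖x‖ ^ 2 - c * ‖x‖ = C * (‖x‖ - c / (2 * C)) ^ 2 := by
    field_simp; ring
  nlinarith [mul_nonneg hC.le (sq_nonneg (‖x‖ - c / (2 * C)))]

lemma ExpGrowth.integrable {f : E → ℝ} (hf : ExpGrowth f) (hm : AEStronglyMeasurable f μ) :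
    Integrable f μ := by
  obtain ⟨B, c, hB, hc, H⟩ := hf
  exact ((integrable_exp_mul_norm_of_isGaussian c).const_mul B).mono' hm (ae_of_all _ H)

end Integrable

/-! ### Gaussian integration by parts -/

/-- Gaussian integration by parts on the line. -/
lemma integral_id_mul_gaussianReal {k k' : ℝ → ℝ} (hk : ∀ z, HasDerivAt k (k' z) z)
    (hg : ExpGrowth k) (hg' : ExpGrowth k') :
    ∫ z, z * k z ∂gaussianReal 0 1 = ∫ z, k' z ∂gaussianReal 0 1 := by
  have hkc : Continuous k := continuous_iff_continuousAt.2 fun z => (hk z).continuousAt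
  have hk'm : Measurable k' := by
    have : k' = deriv k := funext fun z => (hk z).deriv.symm
    rw [this]; exact measurable_deriv k
  have key : ∀ f : ℝ → ℝ, Integrable f (gaussianReal 0 1) →
      Integrable (fun z => gaussianPDFReal 0 1 z * f z) := by
    intro f hf
    rw [gaussianReal_of_var_ne_zero _ one_ne_zero,
      integrable_withDensity_iff_integrable_smul' (measurable_gaussianPDF 0 1)
        (ae_of_all _ fun _ => gaussianPDF_lt_top)] at hf
    simpa [toReal_gaussianPDF] using hf
  have hpdf : ∀ z, HasDerivAt (gaussianPDFReal 0 1) (-(z * gaussianPDFReal 0 1 z)) z := by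
    intro z
    have h0 : HasDerivAt (fun z : ℝ => -(z - 0) ^ 2 / (2 * ((1 : NNReal) : ℝ))) (-z) z := by
      refine HasDerivAt.congr_deriv ((((hasDerivAt_id z).sub_const 0).fun_pow 2).fun_neg.div_const
        (2 * ((1 : NNReal) : ℝ))) ?_
      simp
      ring
    rw [gaussianPDFReal_def]
    refine HasDerivAt.congr_deriv
      (h0.exp.const_mul (Real.sqrt (2 * Real.pi * (1 : NNReal)))⁻¹) ?_
    simp only
    ring
  have hmul : ExpGrowth (fun z : ℝ => z * k z) :=
    (ExpGrowth.norm_id.mono (g := fun z : ℝ => z) fun x => by simp).mul hg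
  have i1 := key _ (hmul.integrable (by fun_prop))
  have i2 := key _ (hg'.integrable hk'm.aestronglyMeasurable)
  have i3 := key _ (hg.integrable hkc.aestronglyMeasurable)
  rw [integral_gaussianReal_eq_integral_smul one_ne_zero,
    integral_gaussianReal_eq_integral_smul one_ne_zero]
  -- Ordinary integration by parts against the density, whose derivative is `-z` times itself.
  -- Integrability of the three products replaces boundary terms.
  have := integral_mul_deriv_eq_deriv_mul_of_integrable (u := gaussianPDFReal 0 1) (v := k)
    (u' := fun z => -(z * gaussianPDFReal 0 1 z)) (v' := k') (fun z _ => hpdf z) (fun z _ => hk z)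
    i2 (i1.neg.congr (ae_of_all _ fun z => by simp only [Pi.mul_apply, Pi.neg_apply]; ring)) i3
  simp only [smul_eq_mul]
  rw [this, ← integral_neg]
  congr 1; ext z; ring

/-- The law of a pair of centered jointly Gaussian variables with unit variances and
covariance `t`. -/
def gaussPair (t : ℝ) : Measure (ℝ × ℝ) :=
  ((gaussianReal 0 1).prod (gaussianReal 0 1)).map
    (fun z => (z.1, t * z.1 + Real.sqrt (1 - t ^ 2) * z.2))

instance (t : ℝ) : IsGaussian (gaussPair t) := by
  let L : ℝ × ℝ →L[ℝ] ℝ × ℝ := (ContinuousLinearMap.fst ℝ ℝ ℝ).prod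
    (t • ContinuousLinearMap.fst ℝ ℝ ℝ + Real.sqrt (1 - t ^ 2) • ContinuousLinearMap.snd ℝ ℝ ℝ)
  have : gaussPair t = ((gaussianReal 0 1).prod (gaussianReal 0 1)).map L := by
    rw [gaussPair]; congr 1
  rw [this]; infer_instance

lemma integral_gaussPair (t : ℝ) {f : ℝ × ℝ → ℝ} (hf : Continuous f) :
    ∫ p, f p ∂gaussPair t = ∫ z, f (z.1, t * z.1 + Real.sqrt (1 - t ^ 2) * z.2)
      ∂((gaussianReal 0 1).prod (gaussianReal 0 1)) := by
  rw [gaussPair, integral_map (by fun_prop) (by fun_prop)]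

/-- A continuous function `f` on the plane whose partial derivatives are `f₁` and `f₂`. -/
def HasGrad (f f₁ f₂ : ℝ × ℝ → ℝ) : Prop :=
  ∀ p, HasFDerivAt f
    (f₁ p • ContinuousLinearMap.fst ℝ ℝ ℝ + f₂ p • ContinuousLinearMap.snd ℝ ℝ ℝ) p

lemma HasGrad.continuous {f f₁ f₂ : ℝ × ℝ → ℝ} (h : HasGrad f f₁ f₂) : Continuous f :=
  continuous_iff_continuousAt.2 fun p => (h p).continuousAt

lemma norm_prod_le_of_abs {p : ℝ × ℝ} {b : ℝ} (h1 : |p.1| ≤ b) (h2 : |p.2| ≤ b) : ‖p‖ ≤ b := by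
  rw [Prod.norm_def]; exact max_le h1 h2

lemma ExpGrowth.integrable_gauss {t : ℝ} {f : ℝ × ℝ → ℝ} (hf : ExpGrowth f)
    (hc : Continuous f) : Integrable f (gaussPair t) :=
  hf.integrable hc.aestronglyMeasurable

/-- Gaussian integration by parts for a correlated pair. -/
lemma integral_mul_gaussPair {t : ℝ} (ht0 : 0 ≤ t) (ht1 : t ≤ 1) {k k₁ k₂ : ℝ × ℝ → ℝ}
    (hk : HasGrad k k₁ k₂) (hc₁ : Continuous k₁) (hc₂ : Continuous k₂)
    (hg : ExpGrowth k) (hg₁ : ExpGrowth k₁) (hg₂ : ExpGrowth k₂) :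
    (∫ p, p.1 * k p ∂gaussPair t = ∫ p, k₁ p + t * k₂ p ∂gaussPair t) ∧
    (∫ p, p.2 * k p ∂gaussPair t = ∫ p, t * k₁ p + k₂ p ∂gaussPair t) := by
  set σ := Real.sqrt (1 - t ^ 2) with hσ
  have hσ2 : σ ^ 2 = 1 - t ^ 2 := Real.sq_sqrt (by nlinarith)
  have hσ0 : 0 ≤ σ := Real.sqrt_nonneg _
  have hσ1 : σ ≤ 1 := by nlinarith [sq_nonneg t]
  have hkc := hk.continuous
  set φ : ℝ × ℝ → ℝ × ℝ := fun z => (z.1, t * z.1 + σ * z.2) with hφ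
  have hφc : Continuous φ := by fun_prop
  have hφn : ∀ z, ‖φ z‖ ≤ 0 + 2 * ‖z‖ := by
    intro z
    have h1 : |z.1| ≤ ‖z‖ := norm_fst_le z
    have h2 : |z.2| ≤ ‖z‖ := norm_snd_le z
    refine norm_prod_le_of_abs (by simp only [hφ]; linarith [abs_nonneg z.1]) ?_
    simp only [hφ]
    calc |t * z.1 + σ * z.2| ≤ |t * z.1| + |σ * z.2| := abs_add_le _ _
      _ = t * |z.1| + σ * |z.2| := by rw [abs_mul, abs_mul, abs_of_nonneg ht0, abs_of_nonneg hσ0]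
      _ ≤ 1 * |z.1| + 1 * |z.2| := by gcongr
      _ ≤ _ := by linarith
  have gφ : ∀ {f : ℝ × ℝ → ℝ}, ExpGrowth f → ExpGrowth (fun z => f (φ z)) :=
    fun hf => hf.comp_of_norm_le φ 0 2 (by norm_num) hφn
  have slice1 : ∀ {f : ℝ × ℝ → ℝ}, ExpGrowth f → ∀ b, ExpGrowth (fun a : ℝ => f (a, b)) :=
    fun hf b => hf.comp_of_norm_le _ |b| 1 (by norm_num) fun a =>
      norm_prod_le_of_abs (by simp) (by simp)
  have slice2 : ∀ {f : ℝ × ℝ → ℝ}, ExpGrowth f → ∀ a, ExpGrowth (fun b : ℝ => f (a, b)) :=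
    fun hf b => hf.comp_of_norm_le _ |b| 1 (by norm_num) fun a =>
      norm_prod_le_of_abs (by simp) (by simp)
  have int : ∀ {f : ℝ × ℝ → ℝ}, ExpGrowth f → Continuous f →
      Integrable f ((gaussianReal 0 1).prod (gaussianReal 0 1)) :=
    fun hf hc => hf.integrable hc.aestronglyMeasurable
  -- One-dimensional integration by parts in one independent coordinate, the other being frozen.
  -- Moving `z.1` moves both components of `φ z`, moving `z.2` only the second.
  have A : ∫ z, z.1 * k (φ z) ∂((gaussianReal 0 1).prod (gaussianReal 0 1)) =
      ∫ z, k₁ (φ z) + t * k₂ (φ z) ∂((gaussianReal 0 1).prod (gaussianReal 0 1)) := by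
    rw [integral_prod_symm _ (int (ExpGrowth.fst.mul (gφ hg)) (by fun_prop)),
      integral_prod_symm _ (int ((gφ hg₁).add ((gφ hg₂).const_mul t)) (by fun_prop))]
    congr 1; ext b
    refine integral_id_mul_gaussianReal (k := fun a => k (φ (a, b))) (fun a => ?_)
      (slice1 (gφ hg) b) (slice1 ((gφ hg₁).add ((gφ hg₂).const_mul t)) b)
    have h1 : HasDerivAt (fun a => φ (a, b)) (1, t) a := by
      refine HasDerivAt.prodMk (hasDerivAt_id a) ?_
      simpa using ((hasDerivAt_id a).const_mul t).add_const (σ * b)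
    simpa [mul_comm, Function.comp_def] using (hk (φ (a, b))).comp_hasDerivAt a h1
  have B : ∫ z, z.2 * k (φ z) ∂((gaussianReal 0 1).prod (gaussianReal 0 1)) =
      ∫ z, σ * k₂ (φ z) ∂((gaussianReal 0 1).prod (gaussianReal 0 1)) := by
    rw [integral_prod _ (int (ExpGrowth.snd.mul (gφ hg)) (by fun_prop)),
      integral_prod _ (int ((gφ hg₂).const_mul σ) (by fun_prop))]
    congr 1; ext a
    refine integral_id_mul_gaussianReal (k := fun b => k (φ (a, b))) (fun b => ?_)
      (slice2 (gφ hg) a) (slice2 ((gφ hg₂).const_mul σ) a)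
    have h1 : HasDerivAt (fun b => φ (a, b)) (0, σ) b := by
      refine HasDerivAt.prodMk (hasDerivAt_const b a) ?_
      simpa using ((hasDerivAt_id b).const_mul σ).const_add (t * a)
    simpa [mul_comm, Function.comp_def] using (hk (φ (a, b))).comp_hasDerivAt b h1
  have i1 := int (gφ hg₁) (by fun_prop)
  have i2 := int (gφ hg₂) (by fun_prop)
  refine ⟨?_, ?_⟩
  · rw [integral_gaussPair t (by fun_prop), integral_gaussPair t (by fun_prop)]
    exact A
  · rw [integral_gaussPair t (by fun_prop), integral_gaussPair t (by fun_prop)]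
    have e : ∀ z : ℝ × ℝ, (t * z.1 + σ * z.2) * k (φ z) =
        t * (z.1 * k (φ z)) + σ * (z.2 * k (φ z)) := fun z => by ring
    change ∫ z, (t * z.1 + σ * z.2) * k (φ z) ∂_ = ∫ z, t * k₁ (φ z) + k₂ (φ z) ∂_
    simp_rw [e]
    rw [integral_add ((int (ExpGrowth.fst.mul (gφ hg)) (by fun_prop)).const_mul t)
      ((int (ExpGrowth.snd.mul (gφ hg)) (by fun_prop)).const_mul σ),
      integral_const_mul, integral_const_mul, A, B, integral_add i1 (i2.const_mul t),
      integral_add (i1.const_mul t) i2, integral_const_mul, integral_const_mul, integral_const_mul]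
    -- The coefficient of the integral of `k₂` is `t² + σ² = 1`.
    linear_combination (∫ z, k₂ (φ z) ∂((gaussianReal 0 1).prod (gaussianReal 0 1))) * hσ2

/-! ### The law of a standard Gaussian pair -/

/-- A Gaussian measure on the plane is determined by its first and second moments; this is the
case of centered measures. -/
lemma isGaussian_prod_ext {μ ν : Measure (ℝ × ℝ)} [IsGaussian μ] [IsGaussian ν]
    (hμ1 : ∫ p, p.1 ∂μ = 0) (hμ2 : ∫ p, p.2 ∂μ = 0)
    (hν1 : ∫ p, p.1 ∂ν = 0) (hν2 : ∫ p, p.2 ∂ν = 0)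
    (h11 : ∫ p, p.1 ^ 2 ∂μ = ∫ p, p.1 ^ 2 ∂ν) (h22 : ∫ p, p.2 ^ 2 ∂μ = ∫ p, p.2 ^ 2 ∂ν)
    (h12 : ∫ p, p.1 * p.2 ∂μ = ∫ p, p.1 * p.2 ∂ν) : μ = ν := by
  have key : ∀ (ρ : Measure (ℝ × ℝ)) [IsGaussian ρ], ∫ p, p.1 ∂ρ = 0 → ∫ p, p.2 ∂ρ = 0 →
      ∀ L : StrongDual ℝ (ℝ × ℝ), ∫ p, L p ∂ρ = 0 ∧ Var[L; ρ] =
        L (1, 0) ^ 2 * ∫ p, p.1 ^ 2 ∂ρ + L (0, 1) ^ 2 * ∫ p, p.2 ^ 2 ∂ρ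
          + 2 * L (1, 0) * L (0, 1) * ∫ p, p.1 * p.2 ∂ρ := by
    intro ρ _ h1 h2 L
    have hL : ∀ p : ℝ × ℝ, L p = L (1, 0) * p.1 + L (0, 1) * p.2 := by
      intro p
      have : p = p.1 • ((1, 0) : ℝ × ℝ) + p.2 • ((0, 1) : ℝ × ℝ) := by ext <;> simp
      conv_lhs => rw [this, map_add, map_smul, map_smul]
      simp only [smul_eq_mul]; ring
    have i : ∀ {f : ℝ × ℝ → ℝ}, ExpGrowth f → Continuous f → Integrable f ρ :=
      fun hf hc => hf.integrable hc.aestronglyMeasurable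
    have i1 := i ExpGrowth.fst (by fun_prop)
    have i2 := i ExpGrowth.snd (by fun_prop)
    have m : ∫ p, L p ∂ρ = 0 := by
      rw [integral_congr_ae (ae_of_all _ hL)]
      rw [integral_add (i1.const_mul _) (i2.const_mul _), integral_const_mul, integral_const_mul,
        h1, h2]
      simp
    refine ⟨m, ?_⟩
    rw [variance_of_integral_eq_zero L.continuous.aemeasurable m]
    have e : ∀ p : ℝ × ℝ, L p ^ 2 = L (1, 0) ^ 2 * p.1 ^ 2 + L (0, 1) ^ 2 * p.2 ^ 2
        + 2 * L (1, 0) * L (0, 1) * (p.1 * p.2) := fun p => by rw [hL p]; ring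
    rw [integral_congr_ae (ae_of_all _ e)]
    have i11 : Integrable (fun p : ℝ × ℝ => p.1 ^ 2) ρ := by
      simpa only [pow_two] using i (ExpGrowth.fst.mul ExpGrowth.fst) (by fun_prop)
    have i22 : Integrable (fun p : ℝ × ℝ => p.2 ^ 2) ρ := by
      simpa only [pow_two] using i (ExpGrowth.snd.mul ExpGrowth.snd) (by fun_prop)
    have i12 : Integrable (fun p : ℝ × ℝ => p.1 * p.2) ρ :=
      i (ExpGrowth.fst.mul ExpGrowth.snd) (by fun_prop)
    have i3 : Integrable (fun p : ℝ × ℝ => L (1, 0) ^ 2 * p.1 ^ 2 + L (0, 1) ^ 2 * p.2 ^ 2) ρ :=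
      (i11.const_mul _).add (i22.const_mul _)
    rw [integral_add i3 (i12.const_mul _),
      integral_add (i11.const_mul _) (i22.const_mul _), integral_const_mul, integral_const_mul,
      integral_const_mul]
  -- The characteristic function of a Gaussian measure at `L` depends only on the mean and variance
  -- of `L`, which `key` expresses through the moments.
  refine Measure.ext_of_charFunDual ?_
  ext L
  obtain ⟨a1, a2⟩ := key μ hμ1 hμ2 L
  obtain ⟨b1, b2⟩ := key ν hν1 hν2 L
  rw [IsGaussian.charFunDual_eq, IsGaussian.charFunDual_eq, integral_complex_ofReal,
    integral_complex_ofReal, a1, b1, a2, b2, h11, h22, h12]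

/-- Integration by parts against the functions `1`, `p.1` and `p.2` produces all five moments. -/
lemma gaussPair_moments {t : ℝ} (ht0 : 0 ≤ t) (ht1 : t ≤ 1) :
    ∫ p, p.1 ∂gaussPair t = 0 ∧ ∫ p, p.2 ∂gaussPair t = 0 ∧ ∫ p, p.1 ^ 2 ∂gaussPair t = 1 ∧
    ∫ p, p.2 ^ 2 ∂gaussPair t = 1 ∧ ∫ p, p.1 * p.2 ∂gaussPair t = t := by
  have h0 : HasGrad (fun _ => (1 : ℝ)) (fun _ => 0) (fun _ => 0) := fun p => by
    simpa using hasFDerivAt_const (1 : ℝ) p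
  have h1 : HasGrad (fun p => p.1) (fun _ => 1) (fun _ => 0) := fun p => by
    simpa using hasFDerivAt_fst (𝕜 := ℝ) (p := p)
  have h2 : HasGrad (fun p => p.2) (fun _ => 0) (fun _ => 1) := fun p => by
    simpa using hasFDerivAt_snd (𝕜 := ℝ) (p := p)
  have a := integral_mul_gaussPair ht0 ht1 h0 (by fun_prop) (by fun_prop)
    (ExpGrowth.const _) (ExpGrowth.const _) (ExpGrowth.const _)
  have b := integral_mul_gaussPair ht0 ht1 h1 (by fun_prop) (by fun_prop)
    ExpGrowth.fst (ExpGrowth.const _) (ExpGrowth.const _)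
  have c := integral_mul_gaussPair ht0 ht1 h2 (by fun_prop) (by fun_prop)
    ExpGrowth.snd (ExpGrowth.const _) (ExpGrowth.const _)
  simp only [mul_one, mul_zero, add_zero, zero_add, integral_zero, integral_const,
    probReal_univ, smul_eq_mul, one_mul] at a b c
  simp only [pow_two]
  exact ⟨a.1, a.2, b.1, c.2, c.1⟩

/-- Reflection preserves Gaussianity, centering and second moments, hence the law. This symmetry is
what allows the shifts in `gap_le_heat` to be paired with their opposites. -/
lemma integral_gaussPair_neg {t : ℝ} (ht0 : 0 ≤ t) (ht1 : t ≤ 1) {f : ℝ × ℝ → ℝ}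
    (hf : Continuous f) : ∫ p, f (-p) ∂gaussPair t = ∫ p, f p ∂gaussPair t := by
  obtain ⟨h1, h2, h3, h4, h5⟩ := gaussPair_moments ht0 ht1
  have : (gaussPair t).map (fun p => -p) = gaussPair t := by
    refine isGaussian_prod_ext ?_ ?_ h1 h2 ?_ ?_ ?_
    all_goals rw [integral_map (by fun_prop) (by fun_prop)]
    all_goals simp [integral_neg, h1, h2]
  conv_rhs => rw [← this]
  rw [integral_map (by fun_prop) (by fun_prop)]

namespace IsStdGaussianPair

variable {S : Type*} [MeasurableSpace S] {P : Measure S}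
    {y₁ y₂ : S → ℝ} {t : ℝ}

lemma le_one (h : IsStdGaussianPair P y₁ y₂ t) : t ≤ 1 := by
  have i1 : Integrable (fun s => y₁ s ^ 2) P := h.gaussian.fst.memLp_two.integrable_sq
  have i2 : Integrable (fun s => y₂ s ^ 2) P := h.gaussian.snd.memLp_two.integrable_sq
  have i12 : Integrable (fun s => y₁ s * y₂ s) P :=
    h.gaussian.fst.memLp_two.integrable_mul h.gaussian.snd.memLp_two
  have : ∫ s, y₁ s * y₂ s ∂P ≤ ∫ s, (y₁ s ^ 2 + y₂ s ^ 2) / 2 ∂P :=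
    integral_mono i12 ((i1.add i2).div_const 2) fun s => by
      simp only
      nlinarith [sq_nonneg (y₁ s - y₂ s)]
  rw [h.corr, integral_div, integral_add i1 i2, h.var_one, h.var_two] at this
  linarith

lemma map_eq (h : IsStdGaussianPair P y₁ y₂ t) (ht0 : 0 ≤ t) :
    P.map (fun s => (y₁ s, y₂ s)) = gaussPair t := by
  obtain ⟨h1, h2, h3, h4, h5⟩ := gaussPair_moments ht0 h.le_one
  have hm := h.gaussian.aemeasurable
  have := h.gaussian.isGaussian_map
  refine isGaussian_prod_ext ?_ ?_ h1 h2 ?_ ?_ ?_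
  all_goals rw [integral_map hm (by fun_prop)]
  · exact h.mean_one
  · exact h.mean_two
  · rw [h3]; exact h.var_one
  · rw [h4]; exact h.var_two
  · rw [h5]; exact h.corr

lemma integral_eq (h : IsStdGaussianPair P y₁ y₂ t) (ht0 : 0 ≤ t) {f : ℝ × ℝ → ℝ}
    (hf : Continuous f) : ∫ s, f (y₁ s, y₂ s) ∂P = ∫ p, f p ∂gaussPair t := by
  rw [← h.map_eq ht0, integral_map h.gaussian.aemeasurable (by fun_prop)]

lemma integrable_comp (h : IsStdGaussianPair P y₁ y₂ t) (ht0 : 0 ≤ t) {f : ℝ × ℝ → ℝ}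
    (hf : Continuous f) (hg : ExpGrowth f) : Integrable (fun s => f (y₁ s, y₂ s)) P := by
  have := hg.integrable_gauss (t := t) hf
  rw [← h.map_eq ht0, integrable_map_measure (by fun_prop) h.gaussian.aemeasurable] at this
  exact this

end IsStdGaussianPair

lemma isStdGaussianPair_gaussPair {t : ℝ} (ht0 : 0 ≤ t) (ht1 : t ≤ 1) :
    IsStdGaussianPair (gaussPair t) Prod.fst Prod.snd t := by
  obtain ⟨h1, h2, h3, h4, h5⟩ := gaussPair_moments ht0 ht1
  exact ⟨IsGaussian.hasGaussianLaw_id, h1, h2, h3, h4, h5⟩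

lemma IsStdGaussianPair.map_fst {S : Type*} [MeasurableSpace S] {P : Measure S}
    {y₁ y₂ : S → ℝ} {t : ℝ} (h : IsStdGaussianPair P y₁ y₂ t) :
    P.map y₁ = gaussianReal 0 1 ∧ P.map y₂ = gaussianReal 0 1 := by
  constructor
  · rw [h.gaussian.fst.map_eq_gaussianReal, variance_of_integral_eq_zero
      h.gaussian.fst.aemeasurable h.mean_one, h.mean_one, h.var_one]
    simp
  · rw [h.gaussian.snd.map_eq_gaussianReal, variance_of_integral_eq_zero
      h.gaussian.snd.aemeasurable h.mean_two, h.mean_two, h.var_two]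
    simp

/-! ### The Gaussian semigroup and the heat equation -/

/-- The linear form `(a, b, c)` on `(ℝ × ℝ) × ℝ`. -/
def linForm (a b c : ℝ) : (ℝ × ℝ) × ℝ →L[ℝ] ℝ :=
  a • ((ContinuousLinearMap.fst ℝ ℝ ℝ).comp (ContinuousLinearMap.fst ℝ (ℝ × ℝ) ℝ))
    + b • ((ContinuousLinearMap.snd ℝ ℝ ℝ).comp (ContinuousLinearMap.fst ℝ (ℝ × ℝ) ℝ))
    + c • ContinuousLinearMap.snd ℝ (ℝ × ℝ) ℝ

@[simp] lemma linForm_apply (a b c : ℝ) (v : (ℝ × ℝ) × ℝ) :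
    linForm a b c v = a * v.1.1 + b * v.1.2 + c * v.2 := by simp [linForm]

lemma norm_linForm_le (a b c : ℝ) : ‖linForm a b c‖ ≤ |a| + |b| + |c| := by
  refine ContinuousLinearMap.opNorm_le_bound _ (by positivity) fun v => ?_
  have h1 : |v.1.1| ≤ ‖v‖ := (norm_fst_le v.1).trans (norm_fst_le v)
  have h2 : |v.1.2| ≤ ‖v‖ := (norm_snd_le v.1).trans (norm_fst_le v)
  have h3 : |v.2| ≤ ‖v‖ := norm_snd_le v
  rw [linForm_apply, Real.norm_eq_abs, add_mul, add_mul]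
  refine (abs_add_three _ _ _).trans ?_
  rw [abs_mul, abs_mul, abs_mul]
  gcongr

/-- The Gaussian semigroup with covariance `t`, applied to the function `f`. -/
def heat (t : ℝ) (f : ℝ × ℝ → ℝ) (x : ℝ × ℝ) (s : ℝ) : ℝ :=
  ∫ p, f (x + Real.sqrt s • p) ∂gaussPair t

@[simp] lemma heat_zero (t : ℝ) (f : ℝ × ℝ → ℝ) (x : ℝ × ℝ) : heat t f x 0 = f x := by
  simp [heat]

/-- Supplies the locally uniform dominating function for continuity and differentiation under the
Gaussian integral. -/
lemma ExpGrowth.exists_bound {f : ℝ × ℝ → ℝ} (hf : ExpGrowth f) (q₀ : (ℝ × ℝ) × ℝ) :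
    ∃ b : ℝ × ℝ → ℝ, Continuous b ∧ ExpGrowth b ∧ (∀ p, 0 ≤ b p) ∧
      ∀ q ∈ Metric.ball q₀ 1, ∀ p, |f (q.1 + q.2 • p)| ≤ b p := by
  obtain ⟨B, c, hB, hc, H⟩ := hf
  refine ⟨fun p => B * Real.exp (c * (‖q₀‖ + 1 + (‖q₀‖ + 1) * ‖p‖)), by fun_prop, ?_,
    fun p => by positivity, fun q hq p => (H _).trans ?_⟩
  · refine ExpGrowth.const_mul B (ExpGrowth.exp ⟨c * (‖q₀‖ + 1), c * (‖q₀‖ + 1),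
      by positivity, fun p => ?_⟩)
    linarith
  · have hq' : ‖q‖ ≤ ‖q₀‖ + 1 := by
      have := norm_sub_norm_le q q₀
      rw [Metric.mem_ball, dist_eq_norm] at hq
      linarith
    refine mul_le_mul_of_nonneg_left (Real.exp_le_exp.2 (mul_le_mul_of_nonneg_left ?_ hc)) hB
    refine (norm_add_le _ _).trans ?_
    rw [norm_smul]
    have h1 := norm_fst_le q
    have h2 := norm_snd_le q
    gcongr <;> linarith

lemma continuous_integral_affine {t : ℝ} {f : ℝ × ℝ → ℝ} (hc : Continuous f) (hf : ExpGrowth f) :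
    Continuous (fun q : (ℝ × ℝ) × ℝ => ∫ p, f (q.1 + q.2 • p) ∂gaussPair t) := by
  refine continuous_iff_continuousAt.2 fun q₀ => ?_
  obtain ⟨b, hbc, hb, -, H⟩ := hf.exists_bound q₀
  refine continuousAt_of_dominated (bound := b)
    (Filter.Eventually.of_forall fun q => Continuous.aestronglyMeasurable (by fun_prop))
    ?_ (hb.integrable_gauss hbc) (ae_of_all _ fun p => by fun_prop)
  filter_upwards [Metric.ball_mem_nhds q₀ one_pos] with q hq
  exact ae_of_all _ fun p => H q hq p

lemma continuous_heat {t : ℝ} {f : ℝ × ℝ → ℝ} (hc : Continuous f) (hf : ExpGrowth f) :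
    Continuous (fun q : (ℝ × ℝ) × ℝ => heat t f q.1 q.2) :=
  (continuous_integral_affine (t := t) hc hf).comp
    (f := fun q : (ℝ × ℝ) × ℝ => (q.1, Real.sqrt q.2)) (by fun_prop)

lemma continuous_heat_left {t : ℝ} {f : ℝ × ℝ → ℝ} (hc : Continuous f) (hf : ExpGrowth f) (s : ℝ) :
    Continuous (fun x => heat t f x s) :=
  (continuous_heat (t := t) hc hf).comp (f := fun x => (x, s)) (by fun_prop)

/-- Differentiation under the integral in the variables `(x, r)` with `r = √s`: the integrand is
smooth in `r` everywhere, whereas `√s` is singular at `0`. -/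
lemma hasFDerivAt_integral_affine {t : ℝ} {f f₁ f₂ : ℝ × ℝ → ℝ} (h : HasGrad f f₁ f₂)
    (hc₁ : Continuous f₁) (hc₂ : Continuous f₂) (hf : ExpGrowth f) (hf₁ : ExpGrowth f₁)
    (hf₂ : ExpGrowth f₂) (x : ℝ × ℝ) (r : ℝ) :
    HasFDerivAt (fun q : (ℝ × ℝ) × ℝ => ∫ p, f (q.1 + q.2 • p) ∂gaussPair t)
      (linForm (∫ p, f₁ (x + r • p) ∂gaussPair t) (∫ p, f₂ (x + r • p) ∂gaussPair t)
        (∫ p, p.1 * f₁ (x + r • p) ∂gaussPair t + ∫ p, p.2 * f₂ (x + r • p) ∂gaussPair t))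
      (x, r) := by
  have hc := h.continuous
  obtain ⟨b₁, hb₁c, hb₁, hb₁0, H₁⟩ := hf₁.exists_bound (x, r)
  obtain ⟨b₂, hb₂c, hb₂, hb₂0, H₂⟩ := hf₂.exists_bound (x, r)
  let F' : (ℝ × ℝ) × ℝ → ℝ × ℝ → ((ℝ × ℝ) × ℝ →L[ℝ] ℝ) := fun q p =>
    linForm (f₁ (q.1 + q.2 • p)) (f₂ (q.1 + q.2 • p))
      (p.1 * f₁ (q.1 + q.2 • p) + p.2 * f₂ (q.1 + q.2 • p))
  have hF'c : ∀ q, Continuous (F' q) := by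
    intro q
    simp only [F', linForm]
    fun_prop
  have key := hasFDerivAt_integral_of_dominated_of_fderiv_le (μ := gaussPair t)
    (F := fun q p => f (q.1 + q.2 • p)) (F' := F') (x₀ := (x, r))
    (bound := fun p => b₁ p + b₂ p + (‖p‖ * b₁ p + ‖p‖ * b₂ p))
    (Metric.ball_mem_nhds _ one_pos)
    (Filter.Eventually.of_forall fun q => Continuous.aestronglyMeasurable (by fun_prop))
    ((hf.comp_affine x r).integrable_gauss (by fun_prop)) (hF'c _).aestronglyMeasurable
    (ae_of_all _ fun p q hq => ?_)
    (((hb₁.add hb₂).add ((ExpGrowth.norm_id.mul hb₁).add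
      (ExpGrowth.norm_id.mul hb₂))).integrable_gauss (by fun_prop))
    (ae_of_all _ fun p q hq => ?_)
  · refine key.congr_fderiv ?_
    have i1 : Integrable (fun p => f₁ (x + r • p)) (gaussPair t) :=
      (hf₁.comp_affine x r).integrable_gauss (by fun_prop)
    have i2 : Integrable (fun p => f₂ (x + r • p)) (gaussPair t) :=
      (hf₂.comp_affine x r).integrable_gauss (by fun_prop)
    have i3 : Integrable (fun p => p.1 * f₁ (x + r • p)) (gaussPair t) :=
      (ExpGrowth.fst.mul (hf₁.comp_affine x r)).integrable_gauss (by fun_prop)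
    have i4 : Integrable (fun p => p.2 * f₂ (x + r • p)) (gaussPair t) :=
      (ExpGrowth.snd.mul (hf₂.comp_affine x r)).integrable_gauss (by fun_prop)
    have i5 : Integrable (fun p => p.1 * f₁ (x + r • p) + p.2 * f₂ (x + r • p)) (gaussPair t) :=
      i3.add i4
    simp only [F', linForm]
    rw [integral_add ((i1.smul_const _).add (i2.smul_const _)) (i5.smul_const _),
      integral_add (i1.smul_const _) (i2.smul_const _), integral_smul_const, integral_smul_const,
      integral_smul_const, integral_add i3 i4]
  · refine (norm_linForm_le _ _ _).trans ?_
    have e1 := H₁ q hq p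
    have e2 := H₂ q hq p
    have n1 : |p.1| ≤ ‖p‖ := norm_fst_le p
    have n2 : |p.2| ≤ ‖p‖ := norm_snd_le p
    gcongr
    refine (abs_add_le _ _).trans ?_
    rw [abs_mul, abs_mul]
    gcongr
  · have h1 : HasFDerivAt (fun q : (ℝ × ℝ) × ℝ => q.1 + q.2 • p)
        (ContinuousLinearMap.fst ℝ (ℝ × ℝ) ℝ
          + (ContinuousLinearMap.snd ℝ (ℝ × ℝ) ℝ).smulRight p) q :=
      hasFDerivAt_fst.add (hasFDerivAt_snd.smul_const p)
    refine ((h (q.1 + q.2 • p)).comp q h1).congr_fderiv ?_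
    refine ContinuousLinearMap.ext fun v => ?_
    simp [F']
    ring

lemma HasGrad.comp_affine {f f₁ f₂ : ℝ × ℝ → ℝ} (h : HasGrad f f₁ f₂) (x : ℝ × ℝ) (r : ℝ) :
    HasGrad (fun p => f (x + r • p)) (fun p => r * f₁ (x + r • p))
      (fun p => r * f₂ (x + r • p)) := by
  intro p
  have h1 : HasFDerivAt (fun p : ℝ × ℝ => x + r • p)
      (r • ContinuousLinearMap.id ℝ (ℝ × ℝ)) p := by
    simpa using ((hasFDerivAt_id p).const_smul r).const_add x
  refine ((h (x + r • p)).comp p h1).congr_fderiv ?_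
  refine ContinuousLinearMap.ext fun v => ?_
  simp
  ring

lemma HasGrad.heat {t : ℝ} {f f₁ f₂ : ℝ × ℝ → ℝ} (h : HasGrad f f₁ f₂)
    (hc₁ : Continuous f₁) (hc₂ : Continuous f₂) (hf : ExpGrowth f) (hf₁ : ExpGrowth f₁)
    (hf₂ : ExpGrowth f₂) (s : ℝ) :
    HasGrad (fun x => heat t f x s) (fun x => heat t f₁ x s) (fun x => heat t f₂ x s) := by
  intro x
  have h1 : HasFDerivAt (fun x : ℝ × ℝ => (x, Real.sqrt s))
      ((ContinuousLinearMap.id ℝ (ℝ × ℝ)).prod 0) x :=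
    (hasFDerivAt_id x).prodMk (hasFDerivAt_const _ _)
  refine ((hasFDerivAt_integral_affine (t := t) h hc₁ hc₂ hf hf₁ hf₂ x
    (Real.sqrt s)).comp x h1).congr_fderiv ?_
  refine ContinuousLinearMap.ext fun v => ?_
  simp [_root_.heat]

/-- `f` is twice continuously differentiable with the given partial derivatives, and all these
functions grow at most exponentially. -/
structure HasHess (f f₁ f₂ f₁₁ f₁₂ f₂₂ : ℝ × ℝ → ℝ) : Prop where
  grad : HasGrad f f₁ f₂
  grad₁ : HasGrad f₁ f₁₁ f₁₂
  grad₂ : HasGrad f₂ f₁₂ f₂₂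
  continuous₁₁ : Continuous f₁₁
  continuous₁₂ : Continuous f₁₂
  continuous₂₂ : Continuous f₂₂
  growth : ExpGrowth f
  growth₁ : ExpGrowth f₁
  growth₂ : ExpGrowth f₂
  growth₁₁ : ExpGrowth f₁₁
  growth₁₂ : ExpGrowth f₁₂
  growth₂₂ : ExpGrowth f₂₂

/-- Integration by parts turns the radial derivative into `r` times the averaged Laplacian with
covariance `t`. The factor `r` will cancel the `1/(2r)` coming from `r = √s`. -/
lemma HasHess.integral_mul {t : ℝ} (ht0 : 0 ≤ t) (ht1 : t ≤ 1) {f f₁ f₂ f₁₁ f₁₂ f₂₂ : ℝ × ℝ → ℝ}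
    (H : HasHess f f₁ f₂ f₁₁ f₁₂ f₂₂) (x : ℝ × ℝ) (r : ℝ) :
    ∫ p, p.1 * f₁ (x + r • p) ∂gaussPair t + ∫ p, p.2 * f₂ (x + r • p) ∂gaussPair t =
      r * (∫ p, f₁₁ (x + r • p) ∂gaussPair t + 2 * t * ∫ p, f₁₂ (x + r • p) ∂gaussPair t
        + ∫ p, f₂₂ (x + r • p) ∂gaussPair t) := by
  have c11 := H.continuous₁₁
  have c12 := H.continuous₁₂
  have c22 := H.continuous₂₂
  have i11 := (H.growth₁₁.comp_affine x r).integrable_gauss (t := t) (by fun_prop)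
  have i12 := (H.growth₁₂.comp_affine x r).integrable_gauss (t := t) (by fun_prop)
  have i22 := (H.growth₂₂.comp_affine x r).integrable_gauss (t := t) (by fun_prop)
  rw [(integral_mul_gaussPair ht0 ht1 (H.grad₁.comp_affine x r) (by fun_prop) (by fun_prop)
      (H.growth₁.comp_affine x r) ((H.growth₁₁.comp_affine x r).const_mul r)
      ((H.growth₁₂.comp_affine x r).const_mul r)).1,
    (integral_mul_gaussPair ht0 ht1 (H.grad₂.comp_affine x r) (by fun_prop) (by fun_prop)
      (H.growth₂.comp_affine x r) ((H.growth₁₂.comp_affine x r).const_mul r)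
      ((H.growth₂₂.comp_affine x r).const_mul r)).2,
    integral_add (i11.const_mul r) ((i12.const_mul r).const_mul t),
    integral_add ((i12.const_mul r).const_mul t) (i22.const_mul r)]
  simp only [integral_const_mul]
  ring

/-- The Gaussian semigroup solves the heat equation. -/
theorem HasHess.hasFDerivAt_heat {t : ℝ} (ht0 : 0 ≤ t) (ht1 : t ≤ 1)
    {f f₁ f₂ f₁₁ f₁₂ f₂₂ : ℝ × ℝ → ℝ} (H : HasHess f f₁ f₂ f₁₁ f₁₂ f₂₂) (x : ℝ × ℝ) {s : ℝ}
    (hs : 0 < s) :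
    HasFDerivAt (fun q : (ℝ × ℝ) × ℝ => heat t f q.1 q.2)
      (linForm (heat t f₁ x s) (heat t f₂ x s)
        ((heat t f₁₁ x s + 2 * t * heat t f₁₂ x s + heat t f₂₂ x s) / 2)) (x, s) := by
  have h1 : HasFDerivAt (fun q : (ℝ × ℝ) × ℝ => (q.1, Real.sqrt q.2))
      ((ContinuousLinearMap.fst ℝ (ℝ × ℝ) ℝ).prod
        ((1 / (2 * Real.sqrt s)) • ContinuousLinearMap.snd ℝ (ℝ × ℝ) ℝ)) (x, s) :=
    hasFDerivAt_fst.prodMk (HasFDerivAt.sqrt (f := fun q : (ℝ × ℝ) × ℝ => q.2) (x := (x, s)) hasFDerivAt_snd hs.ne')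
  refine ((hasFDerivAt_integral_affine (t := t) H.grad H.grad₁.continuous H.grad₂.continuous
    H.growth H.growth₁ H.growth₂ x (Real.sqrt s)).comp (x, s) h1).congr_fderiv ?_
  refine ContinuousLinearMap.ext fun v => ?_
  have hr : Real.sqrt s ≠ 0 := (Real.sqrt_pos.2 hs).ne'
  rw [H.integral_mul ht0 ht1]
  simp [heat]
  field_simp

/-! ### Comparison principle for supersolutions -/

/-- A function `V` of `(x, s)`, continuous, and for `0 < s < w` differentiable in `(x, s)` and
twice differentiable in `x`, with derivatives of uniformly exponential growth. -/
structure HasFlow (w : ℝ) (V V₁ V₂ Vs V₁₁ V₁₂ V₂₂ : ℝ × ℝ → ℝ → ℝ) : Prop where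
  continuous : Continuous (fun q : (ℝ × ℝ) × ℝ => V q.1 q.2)
  hasFDerivAt : ∀ s ∈ Set.Ioo 0 w, ∀ x, HasFDerivAt (fun q : (ℝ × ℝ) × ℝ => V q.1 q.2)
    (linForm (V₁ x s) (V₂ x s) (Vs x s)) (x, s)
  grad₁ : ∀ s ∈ Set.Ioo 0 w, HasGrad (V₁ · s) (V₁₁ · s) (V₁₂ · s)
  grad₂ : ∀ s ∈ Set.Ioo 0 w, HasGrad (V₂ · s) (V₁₂ · s) (V₂₂ · s)
  continuous_time : ∀ s ∈ Set.Ioo 0 w, Continuous (Vs · s)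
  continuous₁₁ : ∀ s ∈ Set.Ioo 0 w, Continuous (V₁₁ · s)
  continuous₁₂ : ∀ s ∈ Set.Ioo 0 w, Continuous (V₁₂ · s)
  continuous₂₂ : ∀ s ∈ Set.Ioo 0 w, Continuous (V₂₂ · s)

lemma HasFlow.grad {w : ℝ} {V V₁ V₂ Vs V₁₁ V₁₂ V₂₂ : ℝ × ℝ → ℝ → ℝ}
    (H : HasFlow w V V₁ V₂ Vs V₁₁ V₁₂ V₂₂) {s : ℝ} (hs : s ∈ Set.Ioo 0 w) :
    HasGrad (V · s) (V₁ · s) (V₂ · s) := by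
  intro x
  have h1 : HasFDerivAt (fun x : ℝ × ℝ => (x, s))
      ((ContinuousLinearMap.id ℝ (ℝ × ℝ)).prod 0) x :=
    (hasFDerivAt_id x).prodMk (hasFDerivAt_const _ _)
  refine ((H.hasFDerivAt s hs x).comp x h1).congr_fderiv ?_
  refine ContinuousLinearMap.ext fun v => ?_
  simp

/-- Supersolutions of the heat equation dominate the Gaussian semigroup. -/
theorem HasFlow.heat_le {t : ℝ} (ht0 : 0 ≤ t) (ht1 : t ≤ 1) {w : ℝ} (hw : 0 ≤ w)
    {V V₁ V₂ Vs V₁₁ V₁₂ V₂₂ : ℝ × ℝ → ℝ → ℝ} (H : HasFlow w V V₁ V₂ Vs V₁₁ V₁₂ V₂₂)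
    {B c : ℝ} (hB : 0 ≤ B) (hc : 0 ≤ c)
    (g : ∀ s ∈ Set.Icc 0 w, ∀ x, |V x s| ≤ B * Real.exp (c * ‖x‖))
    (g₁ : ∀ s ∈ Set.Ioo 0 w, ∀ x, |V₁ x s| ≤ B * Real.exp (c * ‖x‖))
    (g₂ : ∀ s ∈ Set.Ioo 0 w, ∀ x, |V₂ x s| ≤ B * Real.exp (c * ‖x‖))
    (gs : ∀ s ∈ Set.Ioo 0 w, ∀ x, |Vs x s| ≤ B * Real.exp (c * ‖x‖))
    (g₁₁ : ∀ s ∈ Set.Ioo 0 w, ∀ x, |V₁₁ x s| ≤ B * Real.exp (c * ‖x‖))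
    (g₁₂ : ∀ s ∈ Set.Ioo 0 w, ∀ x, |V₁₂ x s| ≤ B * Real.exp (c * ‖x‖))
    (g₂₂ : ∀ s ∈ Set.Ioo 0 w, ∀ x, |V₂₂ x s| ≤ B * Real.exp (c * ‖x‖))
    (ineq : ∀ s ∈ Set.Ioo 0 w, ∀ x, (V₁₁ x s + 2 * t * V₁₂ x s + V₂₂ x s) / 2 ≤ Vs x s)
    (x : ℝ × ℝ) : heat t (V · 0) x w ≤ V x w := by
  have hVc := H.continuous
  have hVcs : ∀ s, Continuous (V · s) := fun s =>
    hVc.comp (f := fun x => (x, s)) (by fun_prop)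
  set E : ℝ × ℝ → ℝ := fun p => B * Real.exp (c * (‖x‖ + Real.sqrt w * ‖p‖)) with hE
  have hEc : Continuous E := by fun_prop
  have hE0 : ∀ p, 0 ≤ E p := fun p => by simp only [hE]; positivity
  have hEg : ExpGrowth E := ExpGrowth.const_mul B (ExpGrowth.exp
    ⟨c * ‖x‖, c * Real.sqrt w, by positivity, fun p => by linarith⟩)
  have hEle : ∀ s, 0 ≤ s → ∀ p, B * Real.exp (c * ‖x + Real.sqrt (w - s) • p‖) ≤ E p := by
    intro s hs p
    refine mul_le_mul_of_nonneg_left (Real.exp_le_exp.2 (mul_le_mul_of_nonneg_left ?_ hc)) hB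
    refine (norm_add_le _ _).trans ?_
    rw [norm_smul, Real.norm_eq_abs, abs_of_nonneg (Real.sqrt_nonneg _)]
    gcongr
    linarith
  -- Duhamel interpolation: `Ψ 0` is the smoothed initial value, `Ψ w` is `V x w`, and `Ψ'` is the
  -- Gaussian average of `Vs - ½ΔV`, which is nonnegative by `ineq`.
  set Ψ : ℝ → ℝ := fun s => ∫ p, V (x + Real.sqrt (w - s) • p) s ∂gaussPair t with hΨ
  have contΨ : ContinuousOn Ψ (Set.Icc 0 w) := by
    refine continuousOn_of_dominated (bound := E) (fun s _ => ?_) (fun s hs => ?_)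
      (hEg.integrable_gauss hEc) (ae_of_all _ fun p => ?_)
    · have := hVcs s
      exact Continuous.aestronglyMeasurable (by fun_prop)
    · exact ae_of_all _ fun p => (g s hs _).trans (hEle s hs.1 p)
    · exact (hVc.comp (f := fun s : ℝ => (x + Real.sqrt (w - s) • p, s))
        (by fun_prop)).continuousOn
  have derivΨ : ∀ s ∈ Set.Ioo 0 w, ∃ d, 0 ≤ d ∧ HasDerivAt Ψ d s := by
    intro s₀ hs₀
    set ρ := Real.sqrt ((w - s₀) / 2) with hρ
    have hρ0 : 0 < ρ := Real.sqrt_pos.2 (by linarith [hs₀.2])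
    let F' : ℝ → ℝ × ℝ → ℝ := fun s p =>
      Vs (x + Real.sqrt (w - s) • p) s
        - (p.1 * V₁ (x + Real.sqrt (w - s) • p) s + p.2 * V₂ (x + Real.sqrt (w - s) • p) s)
          * (1 / (2 * Real.sqrt (w - s)))
    have c1 := (H.grad₁ s₀ hs₀).continuous
    have c2 := (H.grad₂ s₀ hs₀).continuous
    have cs := H.continuous_time s₀ hs₀
    have c11 := H.continuous₁₁ s₀ hs₀
    have c12 := H.continuous₁₂ s₀ hs₀
    have c22 := H.continuous₂₂ s₀ hs₀
    have hF'c : Continuous (F' s₀) := by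
      simp only [F']
      fun_prop
    -- The neighbourhood stops halfway to `w`, so that `√(w - s) ≥ ρ > 0` and the factor `1/√(w -
    -- s)` stays bounded.
    have key := hasDerivAt_integral_of_dominated_loc_of_deriv_le (μ := gaussPair t)
      (F := fun s p => V (x + Real.sqrt (w - s) • p) s) (F' := F') (x₀ := s₀)
      (s := Set.Ioo 0 ((s₀ + w) / 2))
      (bound := fun p => E p + (‖p‖ * E p + ‖p‖ * E p) * (1 / (2 * ρ)))
      (Ioo_mem_nhds hs₀.1 (by linarith [hs₀.2]))
      (Filter.Eventually.of_forall fun s => by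
        have := hVcs s
        exact Continuous.aestronglyMeasurable (by fun_prop))
      ((hEg.mono fun p => by
        rw [abs_of_nonneg (hE0 p)]
        exact (g s₀ ⟨hs₀.1.le, hs₀.2.le⟩ _).trans (hEle s₀ hs₀.1.le p)).integrable_gauss (by
          have := hVcs s₀
          fun_prop))
      hF'c.aestronglyMeasurable
      (ae_of_all _ fun p s hs => ?_)
      ((hEg.add (((ExpGrowth.norm_id.mul hEg).add (ExpGrowth.norm_id.mul hEg)).mul
        (ExpGrowth.const _))).integrable_gauss (by fun_prop))
      (ae_of_all _ fun p s hs => ?_)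
    · refine ⟨∫ p, F' s₀ p ∂gaussPair t, ?_, key.2⟩
      have gr : ∀ {f : ℝ × ℝ → ℝ}, (∀ x, |f x| ≤ B * Real.exp (c * ‖x‖)) → ExpGrowth f :=
        fun h => ⟨B, c, hB, hc, h⟩
      have hess : HasHess (V · s₀) (V₁ · s₀) (V₂ · s₀) (V₁₁ · s₀) (V₁₂ · s₀) (V₂₂ · s₀) :=
        ⟨H.grad hs₀, H.grad₁ s₀ hs₀, H.grad₂ s₀ hs₀, c11, c12, c22,
          gr (g s₀ ⟨hs₀.1.le, hs₀.2.le⟩), gr (g₁ s₀ hs₀), gr (g₂ s₀ hs₀), gr (g₁₁ s₀ hs₀),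
          gr (g₁₂ s₀ hs₀), gr (g₂₂ s₀ hs₀)⟩
      have ibp := hess.integral_mul ht0 ht1 x (Real.sqrt (w - s₀))
      have r0 : Real.sqrt (w - s₀) ≠ 0 := (Real.sqrt_pos.2 (by linarith [hs₀.2])).ne'
      set r := Real.sqrt (w - s₀) with hr
      have is := ((gr (gs s₀ hs₀)).comp_affine x r).integrable_gauss (t := t) (by fun_prop)
      have i1 := (ExpGrowth.fst.mul ((gr (g₁ s₀ hs₀)).comp_affine x r)).integrable_gauss
        (t := t) (by fun_prop)
      have i2 := (ExpGrowth.snd.mul ((gr (g₂ s₀ hs₀)).comp_affine x r)).integrable_gauss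
        (t := t) (by fun_prop)
      have i11 := ((gr (g₁₁ s₀ hs₀)).comp_affine x r).integrable_gauss (t := t) (by fun_prop)
      have i12 := ((gr (g₁₂ s₀ hs₀)).comp_affine x r).integrable_gauss (t := t) (by fun_prop)
      have i22 := ((gr (g₂₂ s₀ hs₀)).comp_affine x r).integrable_gauss (t := t) (by fun_prop)
      have i3 : Integrable (fun p => p.1 * V₁ (x + r • p) s₀ + p.2 * V₂ (x + r • p) s₀)
        (gaussPair t) := i1.add i2
      have i4 : Integrable (fun p => V₁₁ (x + r • p) s₀ + 2 * t * V₁₂ (x + r • p) s₀)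
        (gaussPair t) := i11.add (i12.const_mul _)
      have mono := integral_mono ((i4.add i22).div_const 2) is
        (fun p => ineq s₀ hs₀ (x + r • p))
      simp only [Pi.add_apply] at mono
      rw [integral_div, integral_add i4 i22, integral_add i11 (i12.const_mul _),
        integral_const_mul] at mono
      simp only [F']
      rw [integral_sub is (i3.mul_const _), integral_mul_const, integral_add i1 i2, ibp, sub_nonneg]
      refine le_trans (le_of_eq ?_) mono
      rw [← hr]
      field_simp
    · have hsw : s < w := by linarith [hs.2, hs₀.2]
      have hs' : s ∈ Set.Ioo 0 w := ⟨hs.1, hsw⟩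
      have hρs : ρ ≤ Real.sqrt (w - s) := Real.sqrt_le_sqrt (by linarith [hs.2])
      have e := hEle s hs.1.le p
      have e1 := (g₁ s hs' _).trans e
      have e2 := (g₂ s hs' _).trans e
      have es := (gs s hs' _).trans e
      have n1 : |p.1| ≤ ‖p‖ := norm_fst_le p
      have n2 : |p.2| ≤ ‖p‖ := norm_snd_le p
      rw [Real.norm_eq_abs]
      refine (abs_sub _ _).trans ?_
      rw [abs_mul, abs_of_nonneg (a := 1 / (2 * Real.sqrt (w - s))) (by positivity)]
      have := hE0 p
      gcongr
      refine (abs_add_le _ _).trans ?_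
      rw [abs_mul, abs_mul]
      gcongr
    · have hsw : s < w := by linarith [hs.2, hs₀.2]
      have h1 : HasDerivAt (fun s => Real.sqrt (w - s)) (-1 / (2 * Real.sqrt (w - s))) s :=
        ((hasDerivAt_id s).const_sub w).sqrt (by simp; linarith)
      have h2 : HasDerivAt (fun s => (x + Real.sqrt (w - s) • p, s))
          ((-1 / (2 * Real.sqrt (w - s))) • p, 1) s :=
        ((h1.smul_const p).const_add x).prodMk (hasDerivAt_id s)
      refine ((H.hasFDerivAt s ⟨hs.1, hsw⟩ (x + Real.sqrt (w - s) • p)).comp_hasDerivAt s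
        (f := fun s => (x + Real.sqrt (w - s) • p, s)) h2).congr_deriv ?_
      simp [F']
      ring
  have hmono : MonotoneOn Ψ (Set.Icc 0 w) := by
    refine monotoneOn_of_deriv_nonneg (convex_Icc 0 w) contΨ ?_ ?_
    · rw [interior_Icc]
      intro s hs
      obtain ⟨d, -, h⟩ := derivΨ s hs
      exact h.differentiableAt.differentiableWithinAt
    · rw [interior_Icc]
      intro s hs
      obtain ⟨d, h0, h⟩ := derivΨ s hs
      rwa [h.deriv]
  have := hmono ⟨le_rfl, hw⟩ ⟨hw, le_rfl⟩ hw
  simpa [hΨ, heat] using this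

/-- Supersolutions of `∂U/∂s = ½ ΔU + ½ a |∇U|²` dominate the logarithmic exponential mean of
their initial value. -/
theorem HasFlow.logExpMean_le {t : ℝ} (ht0 : 0 ≤ t) (ht1 : t ≤ 1) {w a : ℝ} (hw : 0 ≤ w)
    (ha : 0 ≤ a) {U U₁ U₂ Us U₁₁ U₁₂ U₂₂ : ℝ × ℝ → ℝ → ℝ}
    (H : HasFlow w U U₁ U₂ Us U₁₁ U₁₂ U₂₂) {B : ℝ} (hB : 0 ≤ B)
    (g : ∀ s ∈ Set.Icc 0 w, ∀ x, |U x s| ≤ B * (1 + ‖x‖))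
    (g₁ : ∀ s ∈ Set.Ioo 0 w, ∀ x, |U₁ x s| ≤ B) (g₂ : ∀ s ∈ Set.Ioo 0 w, ∀ x, |U₂ x s| ≤ B)
    (gs : ∀ s ∈ Set.Ioo 0 w, ∀ x, |Us x s| ≤ B)
    (g₁₁ : ∀ s ∈ Set.Ioo 0 w, ∀ x, |U₁₁ x s| ≤ B)
    (g₁₂ : ∀ s ∈ Set.Ioo 0 w, ∀ x, |U₁₂ x s| ≤ B)
    (g₂₂ : ∀ s ∈ Set.Ioo 0 w, ∀ x, |U₂₂ x s| ≤ B)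
    (ineq : ∀ s ∈ Set.Ioo 0 w, ∀ x, (U₁₁ x s + 2 * t * U₁₂ x s + U₂₂ x s
      + a * (U₁ x s ^ 2 + 2 * t * (U₁ x s * U₂ x s) + U₂ x s ^ 2)) / 2 ≤ Us x s)
    (x : ℝ × ℝ) :
    logExpMean (gaussPair t) a (fun p => U (x + Real.sqrt w • p) 0) ≤ U x w := by
  -- For `a = 0` the inequality is already linear. For `a > 0` the Cole–Hopf substitution `V =
  -- exp(aU)` linearizes it: `∂ₛV - ½ΔV` equals `aV` times the defect of `U`.
  rcases ha.eq_or_lt with rfl | ha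
  · rw [logExpMean, if_pos rfl]
    have low : ∀ y : ℝ × ℝ, B ≤ B * Real.exp (1 * ‖y‖) := fun y =>
      le_mul_of_one_le_right hB (Real.one_le_exp (by positivity))
    refine H.heat_le ht0 ht1 hw hB zero_le_one (fun s hs y => (g s hs y).trans ?_)
      (fun s hs y => (g₁ s hs y).trans (low y)) (fun s hs y => (g₂ s hs y).trans (low y))
      (fun s hs y => (gs s hs y).trans (low y)) (fun s hs y => (g₁₁ s hs y).trans (low y))
      (fun s hs y => (g₁₂ s hs y).trans (low y)) (fun s hs y => (g₂₂ s hs y).trans (low y))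
      (fun s hs y => by simpa using ineq s hs y) x
    gcongr
    linarith [Real.add_one_le_exp (1 * ‖y‖)]
  · set V : ℝ × ℝ → ℝ → ℝ := fun y s => Real.exp (a * U y s) with hV
    have hV0 : ∀ y s, 0 < V y s := fun y s => Real.exp_pos _
    have HV : HasFlow w V (fun y s => a * V y s * U₁ y s) (fun y s => a * V y s * U₂ y s)
        (fun y s => a * V y s * Us y s)
        (fun y s => a * V y s * (U₁₁ y s + a * (U₁ y s * U₁ y s)))
        (fun y s => a * V y s * (U₁₂ y s + a * (U₁ y s * U₂ y s)))
        (fun y s => a * V y s * (U₂₂ y s + a * (U₂ y s * U₂ y s))) := by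
      have hUc := H.continuous
      have cU : ∀ s ∈ Set.Ioo 0 w, Continuous (U · s) := fun s hs => (H.grad hs).continuous
      have cV : ∀ s ∈ Set.Ioo 0 w, Continuous (V · s) := fun s hs =>
        Real.continuous_exp.comp (continuous_const.mul (cU s hs))
      have c1 : ∀ s ∈ Set.Ioo 0 w, Continuous (U₁ · s) := fun s hs => (H.grad₁ s hs).continuous
      have c2 : ∀ s ∈ Set.Ioo 0 w, Continuous (U₂ · s) := fun s hs => (H.grad₂ s hs).continuous
      have gradV : ∀ s ∈ Set.Ioo 0 w, ∀ y, HasFDerivAt (V · s)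
          ((a * V y s * U₁ y s) • ContinuousLinearMap.fst ℝ ℝ ℝ
            + (a * V y s * U₂ y s) • ContinuousLinearMap.snd ℝ ℝ ℝ) y := by
        intro s hs y
        refine (((H.grad hs y).const_mul a).exp).congr_fderiv ?_
        refine ContinuousLinearMap.ext fun v => ?_
        simp [hV]
        ring
      refine ⟨?_, fun s hs y => ?_, fun s hs y => ?_, fun s hs y => ?_, fun s hs => ?_,
        fun s hs => ?_, fun s hs => ?_, fun s hs => ?_⟩
      · exact Real.continuous_exp.comp (continuous_const.mul hUc)
      · refine (((H.hasFDerivAt s hs y).const_mul a).exp).congr_fderiv ?_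
        refine ContinuousLinearMap.ext fun v => ?_
        simp [hV]
        ring
      · refine (((gradV s hs y).const_mul a).mul (H.grad₁ s hs y)).congr_fderiv ?_
        refine ContinuousLinearMap.ext fun v => ?_
        simp
        ring
      · refine (((gradV s hs y).const_mul a).mul (H.grad₂ s hs y)).congr_fderiv ?_
        refine ContinuousLinearMap.ext fun v => ?_
        simp
        ring
      · have := H.continuous_time s hs
        have := cV s hs
        fun_prop
      · have := H.continuous₁₁ s hs
        have := cV s hs
        have := c1 s hs
        fun_prop
      · have := H.continuous₁₂ s hs
        have := cV s hs
        have := c1 s hs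
        have := c2 s hs
        fun_prop
      · have := H.continuous₂₂ s hs
        have := cV s hs
        have := c2 s hs
        fun_prop
    have hVle : ∀ s ∈ Set.Icc 0 w, ∀ y, V y s ≤ Real.exp (a * B) * Real.exp (a * B * ‖y‖) := by
      intro s hs y
      rw [← Real.exp_add]
      refine Real.exp_le_exp.2 ?_
      have := mul_le_mul_of_nonneg_left ((le_abs_self _).trans (g s hs y)) ha.le
      linarith
    have hab : 0 ≤ a * B := by positivity
    -- One factor large enough for `V` (factor `1`), its first derivatives (`aB`) and its second
    -- derivatives (`a(B + aB²)`).
    set M := 1 + a * (B + a * (B * B)) with hM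
    have hM1 : 1 ≤ M := by
      have : 0 ≤ a * (B + a * (B * B)) := by positivity
      linarith
    have hMB : a * B ≤ M := by
      have : 0 ≤ a * (a * (B * B)) := by positivity
      simp only [hM]; linarith
    have first : ∀ s ∈ Set.Ioo 0 w, ∀ y, ∀ u, |u| ≤ B →
        |a * V y s * u| ≤ M * Real.exp (a * B) * Real.exp (a * B * ‖y‖) := by
      intro s hs y u hu
      have h1 := hVle s ⟨hs.1.le, hs.2.le⟩ y
      rw [abs_mul, abs_mul, abs_of_pos ha, abs_of_pos (hV0 y s)]
      calc a * V y s * |u| ≤ a * V y s * B := by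
            have := (hV0 y s).le
            gcongr
        _ = (a * B) * V y s := by ring
        _ ≤ M * (Real.exp (a * B) * Real.exp (a * B * ‖y‖)) := by
            have := (hV0 y s).le
            gcongr
        _ = _ := by ring
    have second : ∀ s ∈ Set.Ioo 0 w, ∀ y, ∀ u u' u'', |u| ≤ B → |u'| ≤ B → |u''| ≤ B →
        |a * V y s * (u + a * (u' * u''))| ≤
          M * Real.exp (a * B) * Real.exp (a * B * ‖y‖) := by
      intro s hs y u u' u'' hu hu' hu''
      have h1 := hVle s ⟨hs.1.le, hs.2.le⟩ y
      have h2 : |u + a * (u' * u'')| ≤ B + a * (B * B) := by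
        refine (abs_add_le _ _).trans ?_
        rw [abs_mul, abs_mul, abs_of_pos ha]
        gcongr
      rw [abs_mul, abs_mul, abs_of_pos ha, abs_of_pos (hV0 y s)]
      calc a * V y s * |u + a * (u' * u'')| ≤ a * V y s * (B + a * (B * B)) := by
            have := (hV0 y s).le
            gcongr
        _ = (M - 1) * V y s := by simp only [hM]; ring
        _ ≤ M * (Real.exp (a * B) * Real.exp (a * B * ‖y‖)) := by
            have := (hV0 y s).le
            have : 0 ≤ M - 1 := by linarith
            gcongr
            linarith
        _ = _ := by ring
    have main := HV.heat_le ht0 ht1 hw (B := M * Real.exp (a * B)) (c := a * B) (by positivity) hab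
      (fun s hs y => by
        rw [abs_of_pos (hV0 y s)]
        refine (hVle s hs y).trans ?_
        exact mul_le_mul_of_nonneg_right (le_mul_of_one_le_left (Real.exp_pos _).le hM1)
          (Real.exp_pos _).le)
      (fun s hs y => first s hs y _ (g₁ s hs y)) (fun s hs y => first s hs y _ (g₂ s hs y))
      (fun s hs y => first s hs y _ (gs s hs y))
      (fun s hs y => second s hs y _ _ _ (g₁₁ s hs y) (g₁ s hs y) (g₁ s hs y))
      (fun s hs y => second s hs y _ _ _ (g₁₂ s hs y) (g₁ s hs y) (g₂ s hs y))
      (fun s hs y => second s hs y _ _ _ (g₂₂ s hs y) (g₂ s hs y) (g₂ s hs y))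
      (fun s hs y => by
        have := mul_le_mul_of_nonneg_left (ineq s hs y) (mul_nonneg ha.le (hV0 y s).le)
        refine le_trans (le_of_eq ?_) this
        ring) x
    rw [logExpMean, if_neg ha.ne']
    have pos : 0 < heat t (V · 0) x w := by
      have hc : Continuous (V · 0) := HV.continuous.comp (f := fun y => (y, (0 : ℝ))) (by fun_prop)
      refine integral_exp_pos (f := fun p => a * U (x + Real.sqrt w • p) 0) ?_
      refine ExpGrowth.integrable_gauss (f := fun p => V (x + Real.sqrt w • p) 0) ?_ (by fun_prop)
      refine ExpGrowth.comp_affine (f := (V · 0)) ⟨Real.exp (a * B), a * B, (Real.exp_pos _).le,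
        hab, fun y => ?_⟩ x _
      rw [abs_of_pos (hV0 y 0)]
      exact hVle 0 ⟨le_rfl, hw⟩ y
    have := Real.log_le_log pos main
    rw [hV] at this
    simp only [Real.log_exp] at this
    rw [one_div, inv_mul_le_iff₀ ha]
    exact this

/-! ### Comparison of increments with those of `tanh` -/

lemma abs_sub_le_of_abs_hasDerivAt_le {f f' : ℝ → ℝ} {M : ℝ} (h : ∀ x, HasDerivAt f (f' x) x)
    (hM : ∀ x, |f' x| ≤ M) (x y : ℝ) : |f x - f y| ≤ M * |x - y| :=
  Convex.norm_image_sub_le_of_norm_hasDerivWithin_le (s := Set.univ)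
    (fun x _ => (h x).hasDerivWithinAt) (fun x _ => hM x) convex_univ trivial trivial

lemma Real.hasDerivAt_tanh (x : ℝ) : HasDerivAt Real.tanh (1 / Real.cosh x ^ 2) x := by
  have h0 := (Real.cosh_pos x).ne'
  have h := (Real.hasDerivAt_sinh x).fun_div (Real.hasDerivAt_cosh x) h0
  have e : Real.tanh = fun x => Real.sinh x / Real.cosh x := funext Real.tanh_eq_sinh_div_cosh
  rw [e]
  refine h.congr_deriv ?_
  rw [← Real.cosh_sq_sub_sinh_sq x]
  ring

/-- If the derivative of `f` is comparable with the derivative of `tanh`, then the increments of `f` are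
comparable with those of `tanh`. -/
lemma sq_sub_comparable {f f' : ℝ → ℝ} {C : ℝ} (hC : 0 < C) (h : ∀ x, HasDerivAt f (f' x) x)
    (lo : ∀ x, 1 / (C * Real.cosh x ^ 2) ≤ f' x) (hi : ∀ x, f' x ≤ C / Real.cosh x ^ 2)
    (x y : ℝ) :
    (Real.tanh x - Real.tanh y) ^ 2 ≤ C ^ 2 * (f x - f y) ^ 2 ∧
      (f x - f y) ^ 2 ≤ C ^ 2 * (Real.tanh x - Real.tanh y) ^ 2 := by
  -- Since `tanh' = 1/cosh²`, the two hypotheses say that `C f - tanh` and `C tanh - f` are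
  -- nondecreasing.
  have d1 : ∀ x, HasDerivAt (fun x => C * f x - Real.tanh x) (C * f' x - 1 / Real.cosh x ^ 2) x :=
    fun x => ((h x).const_mul C).sub (Real.hasDerivAt_tanh x)
  have d2 : ∀ x, HasDerivAt (fun x => C * Real.tanh x - f x) (C * (1 / Real.cosh x ^ 2) - f' x) x :=
    fun x => ((Real.hasDerivAt_tanh x).const_mul C).sub (h x)
  have m0 : Monotone Real.tanh := monotone_of_deriv_nonneg
    (fun x => (Real.hasDerivAt_tanh x).differentiableAt) fun x => by
      rw [(Real.hasDerivAt_tanh x).deriv]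
      positivity
  have m1 : Monotone (fun x => C * f x - Real.tanh x) := monotone_of_deriv_nonneg
    (fun x => (d1 x).differentiableAt) fun x => by
      rw [(d1 x).deriv, sub_nonneg]
      refine le_trans (le_of_eq ?_) (mul_le_mul_of_nonneg_left (lo x) hC.le)
      have := (Real.cosh_pos x).ne'
      field_simp
  have m2 : Monotone (fun x => C * Real.tanh x - f x) := monotone_of_deriv_nonneg
    (fun x => (d2 x).differentiableAt) fun x => by
      rw [(d2 x).deriv, sub_nonneg]
      exact (hi x).trans (le_of_eq (by ring))
  have key : ∀ x y, y ≤ x → (Real.tanh x - Real.tanh y) ^ 2 ≤ C ^ 2 * (f x - f y) ^ 2 ∧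
      (f x - f y) ^ 2 ≤ C ^ 2 * (Real.tanh x - Real.tanh y) ^ 2 := by
    intro x y hxy
    have a0 := m0 hxy
    have a1 := m1 hxy
    have a2 := m2 hxy
    simp only at a1 a2
    have b1 : Real.tanh x - Real.tanh y ≤ C * (f x - f y) := by linarith
    have b0 : 0 ≤ f x - f y := nonneg_of_mul_nonneg_right (by linarith) hC
    rw [← mul_pow, ← mul_pow]
    exact ⟨pow_le_pow_left₀ (by linarith) b1 2, pow_le_pow_left₀ b0 (by linarith) 2⟩
  rcases le_total y x with hxy | hxy
  · exact key x y hxy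
  · have := key y x hxy
    rwa [← neg_sub (f x), ← neg_sub (Real.tanh x), neg_sq, neg_sq] at this

/-! ### The equation satisfied by `T` -/

/-- A flow `T(x, s)` in one space variable, with `T' = T₁`, `T'' = T₂` and
`∂T/∂s = ½ (T'' + m T' ²)`. -/
structure IsLogHeatFlow (m w : ℝ) (T T₁ T₂ : ℝ → ℝ → ℝ) : Prop where
  continuous : Continuous (fun q : ℝ × ℝ => T q.1 q.2)
  hasFDerivAt : ∀ s ∈ Set.Ioo 0 w, ∀ x, HasFDerivAt (fun q : ℝ × ℝ => T q.1 q.2)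
    (T₁ x s • ContinuousLinearMap.fst ℝ ℝ ℝ
      + ((T₂ x s + m * T₁ x s ^ 2) / 2) • ContinuousLinearMap.snd ℝ ℝ ℝ) (x, s)
  hasDerivAt : ∀ s ∈ Set.Icc 0 w, ∀ x, HasDerivAt (T · s) (T₁ x s) x
  hasDerivAt₁ : ∀ s ∈ Set.Icc 0 w, ∀ x, HasDerivAt (T₁ · s) (T₂ x s) x
  continuous₂ : ∀ s ∈ Set.Icc 0 w, Continuous (T₂ · s)
  abs_le₁ : ∀ s ∈ Set.Icc 0 w, ∀ x, |T₁ x s| ≤ 1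
  abs_le₂ : ∀ s ∈ Set.Icc 0 w, ∀ x, |T₂ x s| ≤ 1

lemma smoothT_zero (A : ℝ → ℝ) (m x : ℝ) : smoothT A m x 0 = A x := by
  by_cases hm : m = 0
  · simp [smoothT, logExpMean, hm]
  · simp [smoothT, logExpMean, hm]

/-- Lets the planar theory serve functions of one variable, viewed as functions of the first
coordinate. -/
lemma heat_fst_eq (t : ℝ) (ht0 : 0 ≤ t) (ht1 : t ≤ 1) {f : ℝ → ℝ} (hf : Continuous f) (x x' s : ℝ) :
    heat t (fun p => f p.1) (x, x') s = ∫ y, f (x + y * Real.sqrt s) ∂gaussianReal 0 1 := by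
  have h := (isStdGaussianPair_gaussPair ht0 ht1).map_fst.1
  rw [← h, integral_map (by fun_prop) (by fun_prop), heat]
  simp [mul_comm]

namespace ConditionA

variable {m wmax C₁ : ℝ} {A : ℝ → ℝ}

lemma hasDerivAt_iteratedDeriv (hA : ConditionA m wmax C₁ A) {s : ℝ} (hs : s ∈ Set.Icc 0 wmax)
    {k : ℕ} (hk : k < 4) (x : ℝ) : HasDerivAt (iteratedDeriv k (fun x => smoothT A m x s))
      (iteratedDeriv (k + 1) (fun x => smoothT A m x s) x) x := by
  rw [iteratedDeriv_succ]
  exact (hA.differentiable s hs.1 hs.2 k hk x).hasDerivAt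

lemma abs_deriv_two_le (hA : ConditionA m wmax C₁ A) (hC₁ : 0 < C₁) {s : ℝ}
    (hs : s ∈ Set.Icc 0 wmax) (x : ℝ) :
    |iteratedDeriv 2 (fun x => smoothT A m x s) x| ≤ 1 := by
  have h1 := hA.deriv_two_lower x s hs.1 hs.2
  have h2 := (hA.deriv_two_upper x s hs.1 hs.2).trans (min_le_left _ _)
  have h3 : 0 ≤ 1 / (C₁ * Real.cosh x ^ 2) := by positivity
  exact abs_le.2 ⟨by linarith, h2⟩

/-- A function satisfying condition `𝒜` is twice continuously differentiable, with derivatives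
bounded by one. -/
lemma exists_deriv (hA : ConditionA m wmax C₁ A) (hC₁ : 0 < C₁) (hw : 0 ≤ wmax) :
    ∃ A₁ A₂ : ℝ → ℝ, (∀ x, HasDerivAt A (A₁ x) x) ∧ (∀ x, HasDerivAt A₁ (A₂ x) x) ∧
      Continuous A₂ ∧ (∀ x, |A₁ x| ≤ 1) ∧ ∀ x, |A₂ x| ≤ 1 := by
  have h0 : (0 : ℝ) ∈ Set.Icc 0 wmax := ⟨le_rfl, hw⟩
  have e : (fun x => smoothT A m x 0) = A := funext (smoothT_zero A m)
  have d0 := fun x => hA.hasDerivAt_iteratedDeriv h0 (k := 0) (by norm_num) x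
  have d1 := fun x => hA.hasDerivAt_iteratedDeriv h0 (k := 1) (by norm_num) x
  have d2 := fun x => hA.hasDerivAt_iteratedDeriv h0 (k := 2) (by norm_num) x
  have b1 := fun x => hA.deriv_one x 0 le_rfl hw
  have b2 := hA.abs_deriv_two_le hC₁ h0
  simp only [e, iteratedDeriv_zero, zero_add] at d0 d1 d2 b1 b2
  exact ⟨_, _, d0, d1, continuous_iff_continuousAt.2 fun x => (d2 x).continuousAt, b1, b2⟩

/-- For `m > 0`, `N = exp(mT)` is the heat evolution of `exp(mA)`, and taking logarithms turns `∂ₛN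
= ½N''` into the equation for `T`; for `m = 0`, `T` itself solves the heat equation. Condition `𝒜`
at `w = 0`, where `T` is `A`, gives the smoothness and growth needed for the heat equation. -/
lemma isLogHeatFlow (hA : ConditionA m wmax C₁ A) (hC₁ : 0 < C₁) (hw : 0 ≤ wmax) (hm : 0 ≤ m) :
    IsLogHeatFlow m wmax (smoothT A m)
      (fun x s => iteratedDeriv 1 (fun x => smoothT A m x s) x)
      (fun x s => iteratedDeriv 2 (fun x => smoothT A m x s) x) := by
  obtain ⟨A₁, A₂, dA, dA₁, cA₂, bA₁, bA₂⟩ := hA.exists_deriv hC₁ hw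
  have cA : Continuous A := continuous_iff_continuousAt.2 fun x => (dA x).continuousAt
  have cA₁ : Continuous A₁ := continuous_iff_continuousAt.2 fun x => (dA₁ x).continuousAt
  have growA : ∀ x, |A x| ≤ |A 0| + 1 * |x| := by
    intro x
    have := abs_sub_le_of_abs_hasDerivAt_le dA bA₁ x 0
    rw [sub_zero] at this
    linarith [abs_sub_abs_le_abs_sub (A x) (A 0)]
  have abs_fst : ∀ p : ℝ × ℝ, |p.1| ≤ ‖p‖ := fun p => norm_fst_le p
  have gradFst : ∀ {g g' : ℝ → ℝ}, (∀ x, HasDerivAt g (g' x) x) →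
      HasGrad (fun p => g p.1) (fun p => g' p.1) (fun _ => 0) := by
    intro g g' hg p
    have := (hg p.1).comp_hasFDerivAt p (hasFDerivAt_fst (𝕜 := ℝ) (p := p))
    simpa [Function.comp_def] using this
  have grad0 : HasGrad (fun _ => 0) (fun _ => 0) (fun _ => 0) := fun p => by
    simpa using hasFDerivAt_const (0 : ℝ) p
  have d0 := fun s hs x => hA.hasDerivAt_iteratedDeriv (s := s) hs (k := 0) (by norm_num) x
  have d1 := fun s hs x => hA.hasDerivAt_iteratedDeriv (s := s) hs (k := 1) (by norm_num) x
  have d2 := fun s hs x => hA.hasDerivAt_iteratedDeriv (s := s) hs (k := 2) (by norm_num) x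
  simp only [iteratedDeriv_zero, zero_add, Nat.reduceAdd] at d0 d1 d2
  have embed : ∀ q : ℝ × ℝ, HasFDerivAt (fun q : ℝ × ℝ => ((q.1, (0 : ℝ)), q.2))
      (((ContinuousLinearMap.fst ℝ ℝ ℝ).prod 0).prod (ContinuousLinearMap.snd ℝ ℝ ℝ)) q :=
    fun q => (hasFDerivAt_fst.prodMk (hasFDerivAt_const _ _)).prodMk hasFDerivAt_snd
  have slice : ∀ (x : ℝ), HasDerivAt (fun x => (x, (0 : ℝ))) (1, 0) x := fun x =>
    (hasDerivAt_id x).prodMk (hasDerivAt_const _ _)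
  suffices H : Continuous (fun q : ℝ × ℝ => smoothT A m q.1 q.2) ∧ ∀ s ∈ Set.Ioo 0 wmax, ∀ x,
      HasFDerivAt (fun q : ℝ × ℝ => smoothT A m q.1 q.2)
      (iteratedDeriv 1 (fun x => smoothT A m x s) x • ContinuousLinearMap.fst ℝ ℝ ℝ
      + ((iteratedDeriv 2 (fun x => smoothT A m x s) x
          + m * iteratedDeriv 1 (fun x => smoothT A m x s) x ^ 2) / 2) •
          ContinuousLinearMap.snd ℝ ℝ ℝ) (x, s) from
    ⟨H.1, H.2, d0, d1, fun s hs => continuous_iff_continuousAt.2 fun x => (d2 s hs x).continuousAt,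
      fun s hs x => hA.deriv_one x s hs.1 hs.2, fun s hs x => hA.abs_deriv_two_le hC₁ hs x⟩
  rcases hm.eq_or_lt with rfl | hm
  · have hess : HasHess (fun p => A p.1) (fun p => A₁ p.1) (fun _ => 0) (fun p => A₂ p.1)
        (fun _ => 0) (fun _ => 0) :=
      { grad := gradFst dA
        grad₁ := gradFst dA₁
        grad₂ := grad0
        continuous₁₁ := by fun_prop
        continuous₁₂ := by fun_prop
        continuous₂₂ := by fun_prop
        growth := ((ExpGrowth.const |A 0|).add ExpGrowth.norm_id).mono fun p => by
          refine (growA p.1).trans (le_trans ?_ (le_abs_self _))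
          linarith [abs_fst p]
        growth₁ := ExpGrowth.of_bounded 1 fun p => bA₁ _
        growth₂ := ExpGrowth.const 0
        growth₁₁ := ExpGrowth.of_bounded 1 fun p => bA₂ _
        growth₁₂ := ExpGrowth.const 0
        growth₂₂ := ExpGrowth.const 0 }
    have e : ∀ x s, smoothT A 0 x s = heat 0 (fun p => A p.1) (x, 0) s := by
      intro x s
      rw [heat_fst_eq 0 le_rfl zero_le_one cA, smoothT, logExpMean, if_pos rfl]
    have h1 : ∀ s ∈ Set.Icc 0 wmax, ∀ x, iteratedDeriv 1 (fun x => smoothT A 0 x s) x =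
        heat 0 (fun p => A₁ p.1) (x, 0) s := by
      intro s hs x
      refine (d0 s hs x).unique ?_
      simp only [e]
      have := (hess.grad.heat (t := 0) hess.grad₁.continuous hess.grad₂.continuous hess.growth
        hess.growth₁ hess.growth₂ s (x, 0)).comp_hasDerivAt x (slice x)
      simpa [Function.comp_def] using this
    have h2 : ∀ s ∈ Set.Icc 0 wmax, ∀ x, iteratedDeriv 2 (fun x => smoothT A 0 x s) x =
        heat 0 (fun p => A₂ p.1) (x, 0) s := by
      intro s hs x
      refine (d1 s hs x).unique ?_
      rw [funext (h1 s hs)]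
      have := (hess.grad₁.heat (t := 0) hess.continuous₁₁ hess.continuous₁₂ hess.growth₁
        hess.growth₁₁ hess.growth₁₂ s (x, 0)).comp_hasDerivAt x (slice x)
      simpa [Function.comp_def] using this
    refine ⟨?_, fun s hs x => ?_⟩
    · simp only [e]
      exact (continuous_heat (t := 0) hess.grad.continuous hess.growth).comp
        (f := fun q : ℝ × ℝ => ((q.1, (0 : ℝ)), q.2)) (by fun_prop)
    · have hs' : s ∈ Set.Icc 0 wmax := ⟨hs.1.le, hs.2.le⟩
      rw [h1 s hs', h2 s hs']
      simp only [e]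
      refine ((hess.hasFDerivAt_heat le_rfl zero_le_one (x, 0) hs.1).comp (x, s)
        (embed (x, s))).congr_fderiv ?_
      refine ContinuousLinearMap.ext fun v => ?_
      simp [heat]
  · set φ : ℝ → ℝ := fun x => Real.exp (m * A x) with hφ
    have cφ : Continuous φ := by fun_prop
    have dφ : ∀ x, HasDerivAt φ (m * A₁ x * φ x) x := fun x =>
      ((dA x).const_mul m).exp.congr_deriv (by simp only [hφ]; ring)
    have dφ₁ : ∀ x, HasDerivAt (fun x => m * A₁ x * φ x)
        ((m * A₂ x + (m * A₁ x) * (m * A₁ x)) * φ x) x := fun x =>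
      (((dA₁ x).const_mul m).mul (dφ x)).congr_deriv (by ring)
    have gφ : ExpGrowth (fun p : ℝ × ℝ => φ p.1) :=
      ExpGrowth.exp ⟨m * |A 0|, m, hm.le, fun p => by
        have := mul_le_mul_of_nonneg_left ((le_abs_self _).trans (growA p.1)) hm.le
        have := mul_le_mul_of_nonneg_left (abs_fst p) hm.le
        linarith⟩
    have gA₁ : ExpGrowth (fun p : ℝ × ℝ => m * A₁ p.1) :=
      (ExpGrowth.of_bounded 1 fun p => bA₁ _).const_mul m
    have gA₂ : ExpGrowth (fun p : ℝ × ℝ => m * A₂ p.1) :=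
      (ExpGrowth.of_bounded 1 fun p => bA₂ _).const_mul m
    have hess : HasHess (fun p => φ p.1) (fun p => m * A₁ p.1 * φ p.1) (fun _ => 0)
        (fun p => (m * A₂ p.1 + (m * A₁ p.1) * (m * A₁ p.1)) * φ p.1) (fun _ => 0) (fun _ => 0) :=
      { grad := gradFst dφ
        grad₁ := gradFst dφ₁
        grad₂ := grad0
        continuous₁₁ := by fun_prop
        continuous₁₂ := by fun_prop
        continuous₂₂ := by fun_prop
        growth := gφ
        growth₁ := gA₁.mul gφ
        growth₂ := ExpGrowth.const 0
        growth₁₁ := (gA₂.add (gA₁.mul gA₁)).mul gφ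
        growth₁₂ := ExpGrowth.const 0
        growth₂₂ := ExpGrowth.const 0 }
    set N : ℝ → ℝ → ℝ := fun x s => heat 0 (fun p => φ p.1) (x, 0) s with hN
    have N0 : ∀ x s, 0 < N x s := by
      intro x s
      refine integral_exp_pos (μ := gaussPair 0) (f := fun p : ℝ × ℝ => m * A (((x, 0) + Real.sqrt s • p).1)) ?_
      exact (gφ.comp_affine (x, 0) (Real.sqrt s)).integrable_gauss (by fun_prop)
    have e : ∀ x s, smoothT A m x s = 1 / m * Real.log (N x s) := by
      intro x s
      simp only [hN]
      rw [heat_fst_eq 0 le_rfl zero_le_one cφ, smoothT, logExpMean, if_neg hm.ne']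
    have eN : ∀ x s, N x s = Real.exp (m * smoothT A m x s) := by
      intro x s
      rw [e, ← mul_assoc, mul_one_div_cancel hm.ne', one_mul, Real.exp_log (N0 x s)]
    set N₁ : ℝ → ℝ → ℝ := fun x s => heat 0 (fun p => m * A₁ p.1 * φ p.1) (x, 0) s with hN₁
    set N₂ : ℝ → ℝ → ℝ := fun x s =>
      heat 0 (fun p => (m * A₂ p.1 + (m * A₁ p.1) * (m * A₁ p.1)) * φ p.1) (x, 0) s with hN₂
    have dN : ∀ s x, HasDerivAt (N · s) (N₁ x s) x := by
      intro s x
      have := (hess.grad.heat (t := 0) hess.grad₁.continuous hess.grad₂.continuous hess.growth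
        hess.growth₁ hess.growth₂ s (x, 0)).comp_hasDerivAt x (slice x)
      simpa [Function.comp_def] using this
    have dN₁ : ∀ s x, HasDerivAt (N₁ · s) (N₂ x s) x := by
      intro s x
      have := (hess.grad₁.heat (t := 0) hess.continuous₁₁ hess.continuous₁₂ hess.growth₁
        hess.growth₁₁ hess.growth₁₂ s (x, 0)).comp_hasDerivAt x (slice x)
      simpa [Function.comp_def] using this
    -- Uniqueness of derivatives identifies the Gaussian integrals `N₁`, `N₂` with the derivatives
    -- of `exp(mT)`, so that the time derivative `N₂/2` is expressed through the iterated
    -- derivatives of `T`.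
    have h1 : ∀ s ∈ Set.Icc 0 wmax, ∀ x, N₁ x s =
        m * iteratedDeriv 1 (fun x => smoothT A m x s) x * N x s := by
      intro s hs x
      refine (dN s x).unique ?_
      rw [funext (fun x => eN x s)]
      exact ((d0 s hs x).const_mul m).exp.congr_deriv (by rw [← eN]; ring)
    have h2 : ∀ s ∈ Set.Icc 0 wmax, ∀ x, N₂ x s = m * (iteratedDeriv 2 (fun x => smoothT A m x s) x
        + m * iteratedDeriv 1 (fun x => smoothT A m x s) x ^ 2) * N x s := by
      intro s hs x
      refine (dN₁ s x).unique ?_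
      rw [funext (h1 s hs)]
      refine (((d1 s hs x).const_mul m).mul (dN s x)).congr_deriv ?_
      rw [h1 s hs]
      ring
    refine ⟨?_, fun s hs x => ?_⟩
    · simp only [e]
      have : Continuous (fun q : ℝ × ℝ => N q.1 q.2) :=
        (continuous_heat (t := 0) hess.grad.continuous hess.growth).comp
          (f := fun q : ℝ × ℝ => ((q.1, (0 : ℝ)), q.2)) (by fun_prop)
      exact continuous_const.mul (this.log fun q => (N0 _ _).ne')
    · have hs' : s ∈ Set.Icc 0 wmax := ⟨hs.1.le, hs.2.le⟩
      have dd : HasFDerivAt (fun q : ℝ × ℝ => N q.1 q.2) (N₁ x s • ContinuousLinearMap.fst ℝ ℝ ℝ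
          + (N₂ x s / 2) • ContinuousLinearMap.snd ℝ ℝ ℝ) (x, s) := by
        refine ((hess.hasFDerivAt_heat le_rfl zero_le_one (x, 0) hs.1).comp (x, s)
          (embed (x, s))).congr_fderiv ?_
        refine ContinuousLinearMap.ext fun v => ?_
        simp [heat, hN₁, hN₂]
      have e' : (fun q : ℝ × ℝ => smoothT A m q.1 q.2) =
          fun q => 1 / m * Real.log (N q.1 q.2) := funext fun q => e _ _
      rw [e']
      refine ((dd.log (N0 x s).ne').const_mul (1 / m)).congr_fderiv ?_
      refine ContinuousLinearMap.ext fun v => ?_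
      rw [h1 s hs', h2 s hs']
      have := (N0 x s).ne'
      simp
      field_simp

end ConditionA

/-! ### The gap: derivatives and pointwise bounds -/

lemma Real.continuous_tanh' : Continuous Real.tanh :=
  continuous_iff_continuousAt.2 fun x => (Real.hasDerivAt_tanh x).continuousAt

lemma Real.tanh_sq_lt_one' (x : ℝ) : Real.tanh x ^ 2 < 1 := by
  have h := Real.cosh_sq_sub_sinh_sq x
  have h0 := Real.cosh_pos x
  rw [Real.tanh_eq_sinh_div_cosh, div_pow, div_lt_one (by positivity)]
  linarith

lemma Real.hasDerivAt_tanh_sq (x : ℝ) : HasDerivAt Real.tanh (1 - Real.tanh x ^ 2) x := by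
  refine (Real.hasDerivAt_tanh x).congr_deriv ?_
  have h := Real.cosh_sq_sub_sinh_sq x
  have h0 := (Real.cosh_pos x).ne'
  rw [Real.tanh_eq_sinh_div_cosh]
  field_simp
  linarith

/-- The squared difference of hyperbolic tangents. -/
def gap (p : ℝ × ℝ) : ℝ := (Real.tanh p.1 - Real.tanh p.2) ^ 2

/-- The first partial derivative of `gap`. -/
def gap₁ (p : ℝ × ℝ) : ℝ := 2 * (Real.tanh p.1 - Real.tanh p.2) * (1 - Real.tanh p.1 ^ 2)

/-- The second partial derivative of `gap`. -/
def gap₂ (p : ℝ × ℝ) : ℝ := -2 * (Real.tanh p.1 - Real.tanh p.2) * (1 - Real.tanh p.2 ^ 2)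

/-- The second derivative of `gap` in the first variable. -/
def gap₁₁ (p : ℝ × ℝ) : ℝ := 2 * (1 - Real.tanh p.1 ^ 2) ^ 2
  - 4 * (Real.tanh p.1 - Real.tanh p.2) * (Real.tanh p.1 * (1 - Real.tanh p.1 ^ 2))

/-- The mixed second derivative of `gap`. -/
def gap₁₂ (p : ℝ × ℝ) : ℝ := -2 * (1 - Real.tanh p.1 ^ 2) * (1 - Real.tanh p.2 ^ 2)

/-- The second derivative of `gap` in the second variable. -/
def gap₂₂ (p : ℝ × ℝ) : ℝ := 2 * (1 - Real.tanh p.2 ^ 2) ^ 2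
  + 4 * (Real.tanh p.1 - Real.tanh p.2) * (Real.tanh p.2 * (1 - Real.tanh p.2 ^ 2))

lemma gap_nonneg (p : ℝ × ℝ) : 0 ≤ gap p := sq_nonneg _

/-- With `a, b` the two hyperbolic tangents, each partial derivative carries one factor `a - b`.
Their sum carries two, since `(1 - a²) - (1 - b²) = -(a - b)(a + b)`: this diagonal cancellation is
what controls the cross term later. -/
lemma gap_bounds (p : ℝ × ℝ) : gap p ≤ 4 ∧ gap₁ p ^ 2 ≤ 4 * gap p ∧ gap₂ p ^ 2 ≤ 4 * gap p ∧
    |gap₁ p + gap₂ p| ≤ 4 * gap p ∧ |gap₁₁ p| ≤ 10 ∧ |gap₁₂ p| ≤ 2 ∧ |gap₂₂ p| ≤ 10 := by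
  have ha2 := (Real.tanh_sq_lt_one' p.1).le
  have hb2 := (Real.tanh_sq_lt_one' p.2).le
  simp only [gap, gap₁, gap₂, gap₁₁, gap₁₂, gap₂₂]
  set a := Real.tanh p.1
  set b := Real.tanh p.2
  obtain ⟨ha, ha'⟩ := abs_le.1 ((sq_le_one_iff_abs_le_one a).1 ha2)
  obtain ⟨hb, hb'⟩ := abs_le.1 ((sq_le_one_iff_abs_le_one b).1 hb2)
  have hD : |a - b| ≤ 2 := abs_le.2 ⟨by linarith, by linarith⟩
  have hA : |a| ≤ 1 := abs_le.2 ⟨ha, ha'⟩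
  have hB : |b| ≤ 1 := abs_le.2 ⟨hb, hb'⟩
  have hu0 : 0 ≤ 1 - a ^ 2 := by linarith
  have hv0 : 0 ≤ 1 - b ^ 2 := by linarith
  have hu : |1 - a ^ 2| ≤ 1 := abs_le.2 ⟨by linarith, by linarith [sq_nonneg a]⟩
  have hv : |1 - b ^ 2| ≤ 1 := abs_le.2 ⟨by linarith, by linarith [sq_nonneg b]⟩
  have hu2 := (sq_le_one_iff_abs_le_one _).2 hu
  have hv2 := (sq_le_one_iff_abs_le_one _).2 hv
  have third : ∀ D c u : ℝ, |D| ≤ 2 → |c| ≤ 1 → |u| ≤ 1 → |4 * D * (c * u)| ≤ 8 := by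
    intro D c u hD hc hu
    rw [abs_mul, abs_mul, abs_mul, abs_of_pos (by norm_num : (0 : ℝ) < 4)]
    calc 4 * |D| * (|c| * |u|) ≤ 4 * 2 * (1 * 1) := by gcongr
      _ = 8 := by norm_num
  refine ⟨?_, ?_, ?_, ?_, ?_, ?_, ?_⟩
  · have := sq_le_sq' (abs_le.1 hD).1 (abs_le.1 hD).2
    linarith
  · nlinarith [mul_le_mul_of_nonneg_left hu2 (sq_nonneg (a - b))]
  · nlinarith [mul_le_mul_of_nonneg_left hv2 (sq_nonneg (a - b))]
  · have e : 2 * (a - b) * (1 - a ^ 2) + -2 * (a - b) * (1 - b ^ 2) =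
        (a - b) ^ 2 * (-2 * (a + b)) := by ring
    rw [e, abs_mul, abs_of_nonneg (sq_nonneg _), mul_comm]
    gcongr
    exact abs_le.2 ⟨by linarith, by linarith⟩
  · refine (abs_sub _ _).trans ?_
    have := third (a - b) a (1 - a ^ 2) hD hA hu
    rw [abs_of_nonneg (by positivity : 0 ≤ 2 * (1 - a ^ 2) ^ 2)]
    linarith
  · rw [abs_mul, abs_mul, abs_neg, abs_of_pos (by norm_num : (0 : ℝ) < 2)]
    calc 2 * |1 - a ^ 2| * |1 - b ^ 2| ≤ 2 * 1 * 1 := by gcongr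
      _ = 2 := by norm_num
  · refine (abs_add_le _ _).trans ?_
    have := third (a - b) b (1 - b ^ 2) hD hB hv
    rw [abs_of_nonneg (by positivity : 0 ≤ 2 * (1 - b ^ 2) ^ 2)]
    linarith

/-- With `u = 1 - a²`, `v = 1 - b²`, the Laplacian is `2(u² + v² - 2tuv) - 4(a - b)(au - bv)`. The
first part is nonnegative because `t ≤ 1`, and `(a - b)(au - bv) = (a - b)²(1 - a² - ab - b²) ≤ (a -
b)²`. -/
lemma gap_laplacian_ge {t : ℝ} (ht1 : t ≤ 1) (p : ℝ × ℝ) :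
    -4 * gap p ≤ gap₁₁ p + 2 * t * gap₁₂ p + gap₂₂ p := by
  have ha2 := (Real.tanh_sq_lt_one' p.1).le
  have hb2 := (Real.tanh_sq_lt_one' p.2).le
  simp only [gap, gap₁₁, gap₁₂, gap₂₂]
  set a := Real.tanh p.1
  set b := Real.tanh p.2
  set u := 1 - a ^ 2 with hu
  set v := 1 - b ^ 2 with hv
  have huv : 0 ≤ u * v := mul_nonneg (by linarith) (by linarith)
  have h1 : 0 ≤ u ^ 2 + v ^ 2 - 2 * t * (u * v) := by
    nlinarith [sq_nonneg (u - v), mul_nonneg (sub_nonneg.2 ht1) huv]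
  have h2 : 0 ≤ (a - b) ^ 2 * (a ^ 2 + a * b + b ^ 2) :=
    mul_nonneg (sq_nonneg _) (by nlinarith [sq_nonneg (a + b), sq_nonneg a, sq_nonneg b])
  have h3 : (a - b) * (a * u) - (a - b) * (b * v) =
      (a - b) ^ 2 - (a - b) ^ 2 * (a ^ 2 + a * b + b ^ 2) := by
    rw [hu, hv]; ring
  linarith

lemma hasHess_gap : HasHess gap gap₁ gap₂ gap₁₁ gap₁₂ gap₂₂ := by
  have hc := Real.continuous_tanh'
  have f1 : ∀ p : ℝ × ℝ, HasFDerivAt (fun p : ℝ × ℝ => Real.tanh p.1)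
      ((1 - Real.tanh p.1 ^ 2) • ContinuousLinearMap.fst ℝ ℝ ℝ) p := fun p =>
    (Real.hasDerivAt_tanh_sq p.1).comp_hasFDerivAt p hasFDerivAt_fst
  have f2 : ∀ p : ℝ × ℝ, HasFDerivAt (fun p : ℝ × ℝ => Real.tanh p.2)
      ((1 - Real.tanh p.2 ^ 2) • ContinuousLinearMap.snd ℝ ℝ ℝ) p := fun p =>
    (Real.hasDerivAt_tanh_sq p.2).comp_hasFDerivAt p hasFDerivAt_snd
  have root : ∀ {x : ℝ} {g : ℝ × ℝ}, x ^ 2 ≤ 4 * gap g → |x| ≤ 4 := by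
    intro x g h
    refine abs_le_of_sq_le_sq (h.trans ?_) (by norm_num)
    linarith [(gap_bounds g).1]
  exact
    { grad := fun p => by
        refine (HasFDerivAt.pow ((f1 p).sub (f2 p)) 2).congr_fderiv ?_
        refine ContinuousLinearMap.ext fun v => ?_
        simp [gap₁, gap₂]
        ring
      grad₁ := fun p => by
        refine ((((f1 p).sub (f2 p)).const_mul 2).mul
          ((HasFDerivAt.pow (f1 p) 2).const_sub 1)).congr_fderiv ?_
        refine ContinuousLinearMap.ext fun v => ?_
        simp [gap₁₁, gap₁₂]
        ring
      grad₂ := fun p => by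
        refine ((((f1 p).sub (f2 p)).const_mul (-2)).mul
          ((HasFDerivAt.pow (f2 p) 2).const_sub 1)).congr_fderiv ?_
        refine ContinuousLinearMap.ext fun v => ?_
        simp [gap₁₂, gap₂₂]
        ring
      continuous₁₁ := by unfold gap₁₁; fun_prop
      continuous₁₂ := by unfold gap₁₂; fun_prop
      continuous₂₂ := by unfold gap₂₂; fun_prop
      growth := ExpGrowth.of_bounded 4 fun p => by
        rw [abs_of_nonneg (gap_nonneg p)]; exact (gap_bounds p).1
      growth₁ := ExpGrowth.of_bounded 4 fun p => root (gap_bounds p).2.1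
      growth₂ := ExpGrowth.of_bounded 4 fun p => root (gap_bounds p).2.2.1
      growth₁₁ := ExpGrowth.of_bounded 10 fun p => (gap_bounds p).2.2.2.2.1
      growth₁₂ := ExpGrowth.of_bounded 2 fun p => (gap_bounds p).2.2.2.2.2.1
      growth₂₂ := ExpGrowth.of_bounded 10 fun p => (gap_bounds p).2.2.2.2.2.2 }

/-! ### Bounds for the smoothed gap -/

section HeatOrder

variable {t : ℝ} {f g : ℝ × ℝ → ℝ}

lemma integrable_heat (hc : Continuous f) (hf : ExpGrowth f) (x : ℝ × ℝ) (s : ℝ) :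
    Integrable (fun p => f (x + Real.sqrt s • p)) (gaussPair t) :=
  (hf.comp_affine x (Real.sqrt s)).integrable_gauss (by fun_prop)

lemma heat_mono (hc : Continuous f) (hf : ExpGrowth f) (hc' : Continuous g) (hg : ExpGrowth g)
    (h : ∀ p, f p ≤ g p) (x : ℝ × ℝ) (s : ℝ) : heat t f x s ≤ heat t g x s :=
  integral_mono (integrable_heat hc hf x s) (integrable_heat hc' hg x s) fun _ => h _

lemma heat_const (t a : ℝ) (x : ℝ × ℝ) (s : ℝ) : heat t (fun _ => a) x s = a := by simp [heat]

lemma heat_const_mul (a : ℝ) (x : ℝ × ℝ) (s : ℝ) :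
    heat t (fun p => a * f p) x s = a * heat t f x s := integral_const_mul _ _

lemma heat_add (hc : Continuous f) (hf : ExpGrowth f) (hc' : Continuous g) (hg : ExpGrowth g)
    (x : ℝ × ℝ) (s : ℝ) : heat t (fun p => f p + g p) x s = heat t f x s + heat t g x s :=
  integral_add (integrable_heat hc hf x s) (integrable_heat hc' hg x s)

lemma abs_heat_le (hc : Continuous f) (hf : ExpGrowth f) (hc' : Continuous g) (hg : ExpGrowth g)
    (h : ∀ p, |f p| ≤ g p) (x : ℝ × ℝ) (s : ℝ) : |heat t f x s| ≤ heat t g x s := by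
  refine abs_le.2 ⟨?_, heat_mono hc hf hc' hg (fun p => (le_abs_self _).trans (h p)) x s⟩
  have := heat_mono (t := t) (f := fun p => -1 * f p) (by fun_prop) (hf.const_mul _) hc' hg
    (fun p => by simpa using (neg_le_abs _).trans (h p)) x s
  rw [heat_const_mul] at this
  linarith

/-- Jensen's inequality, by averaging `(f - c)² ≥ 0` with `c` the mean of `f`. -/
lemma sq_heat_le (hc : Continuous f) (hf : ExpGrowth f) (x : ℝ × ℝ) (s : ℝ) :
    heat t f x s ^ 2 ≤ heat t (fun p => f p * f p) x s := by
  set c := heat t f x s with hcdef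
  have h := heat_mono (t := t) (f := fun p => 2 * c * f p + -c ^ 2) (by fun_prop)
    ((hf.const_mul _).add (ExpGrowth.const _)) (g := fun p => f p * f p) (by fun_prop)
    (hf.mul hf) (fun p => by nlinarith [sq_nonneg (f p - c)]) x s
  rw [heat_add (f := fun p => 2 * c * f p) (by fun_prop) (hf.const_mul _) (by fun_prop)
    (ExpGrowth.const _), heat_const_mul, heat_const, ← hcdef] at h
  linarith

end HeatOrder

/-- The pointwise bounds of `gap_bounds` survive averaging with the same constants, the quadratic
ones through `sq_heat_le`; the bound `2` on the mixed derivative is relaxed to `10` for uniformity.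
-/
lemma heat_gap_bounds (t : ℝ) (x : ℝ × ℝ) (s : ℝ) :
    0 ≤ heat t gap x s ∧ heat t gap x s ≤ 4 ∧
    heat t gap₁ x s ^ 2 ≤ 4 * heat t gap x s ∧ heat t gap₂ x s ^ 2 ≤ 4 * heat t gap x s ∧
    |heat t gap₁ x s + heat t gap₂ x s| ≤ 4 * heat t gap x s ∧ |heat t gap₁₁ x s| ≤ 10 ∧
    |heat t gap₁₂ x s| ≤ 10 ∧ |heat t gap₂₂ x s| ≤ 10 := by
  have H := hasHess_gap
  have c := H.grad.continuous
  have c1 := H.grad₁.continuous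
  have c2 := H.grad₂.continuous
  have k : ∀ a : ℝ, ExpGrowth (fun _ : ℝ × ℝ => a) := ExpGrowth.const
  refine ⟨integral_nonneg fun p => gap_nonneg _, ?_, ?_, ?_, ?_, ?_, ?_, ?_⟩
  · rw [← heat_const t 4 x s]
    exact heat_mono c H.growth (by fun_prop) (k 4) (fun p => (gap_bounds p).1) x s
  · refine (sq_heat_le c1 H.growth₁ x s).trans ?_
    rw [← heat_const_mul]
    exact heat_mono (by fun_prop) (H.growth₁.mul H.growth₁) (by fun_prop) (H.growth.const_mul 4)
      (fun p => by rw [← pow_two]; exact (gap_bounds p).2.1) x s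
  · refine (sq_heat_le c2 H.growth₂ x s).trans ?_
    rw [← heat_const_mul]
    exact heat_mono (by fun_prop) (H.growth₂.mul H.growth₂) (by fun_prop) (H.growth.const_mul 4)
      (fun p => by rw [← pow_two]; exact (gap_bounds p).2.2.1) x s
  · rw [← heat_const_mul, ← heat_add c1 H.growth₁ c2 H.growth₂]
    exact abs_heat_le (by fun_prop) (H.growth₁.add H.growth₂) (by fun_prop)
      (H.growth.const_mul 4) (fun p => (gap_bounds p).2.2.2.1) x s
  · rw [← heat_const t 10 x s]
    exact abs_heat_le H.continuous₁₁ H.growth₁₁ (by fun_prop) (k 10)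
      (fun p => (gap_bounds p).2.2.2.2.1) x s
  · rw [← heat_const t 10 x s]
    exact abs_heat_le H.continuous₁₂ H.growth₁₂ (by fun_prop) (k 10)
      (fun p => (gap_bounds p).2.2.2.2.2.1.trans (by norm_num)) x s
  · rw [← heat_const t 10 x s]
    exact abs_heat_le H.continuous₂₂ H.growth₂₂ (by fun_prop) (k 10)
      (fun p => (gap_bounds p).2.2.2.2.2.2) x s

/-! ### Control of the gap by its smoothing -/

lemma Real.cosh_add_le (x δ : ℝ) : Real.cosh (x + δ) ≤ Real.exp |δ| * Real.cosh x := by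
  rw [Real.cosh_eq, Real.cosh_eq, Real.exp_add, neg_add, Real.exp_add]
  have h1 : Real.exp δ ≤ Real.exp |δ| := Real.exp_le_exp.2 (le_abs_self δ)
  have h2 : Real.exp (-δ) ≤ Real.exp |δ| := Real.exp_le_exp.2 (neg_le_abs δ)
  nlinarith [mul_le_mul_of_nonneg_left h1 (Real.exp_pos x).le,
    mul_le_mul_of_nonneg_left h2 (Real.exp_pos (-x)).le]

lemma gap_eq (p : ℝ × ℝ) :
    gap p = Real.sinh (p.1 - p.2) ^ 2 / (Real.cosh p.1 ^ 2 * Real.cosh p.2 ^ 2) := by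
  have h1 := (Real.cosh_pos p.1).ne'
  have h2 := (Real.cosh_pos p.2).ne'
  rw [gap, Real.tanh_eq_sinh_div_cosh, Real.tanh_eq_sinh_div_cosh, Real.sinh_sub]
  field_simp

lemma gap_add_ge (x δ : ℝ × ℝ) :
    Real.exp (-(2 * (|δ.1| + |δ.2|))) * (Real.sinh (x.1 - x.2 + (δ.1 - δ.2)) ^ 2 /
      (Real.cosh x.1 ^ 2 * Real.cosh x.2 ^ 2)) ≤ gap (x + δ) := by
  have c1 := Real.cosh_pos x.1
  have c2 := Real.cosh_pos x.2
  have d1 := Real.cosh_pos (x.1 + δ.1)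
  have d2 := Real.cosh_pos (x.2 + δ.2)
  have e1 := Real.cosh_add_le x.1 δ.1
  have e2 := Real.cosh_add_le x.2 δ.2
  have E : Real.exp (-(2 * (|δ.1| + |δ.2|))) = 1 / (Real.exp |δ.1| ^ 2 * Real.exp |δ.2| ^ 2) := by
    rw [← Real.exp_nat_mul, ← Real.exp_nat_mul, ← Real.exp_add, one_div, ← Real.exp_neg]
    congr 1
    push_cast
    ring
  rw [gap_eq, E, Prod.fst_add, Prod.snd_add,
    show x.1 + δ.1 - (x.2 + δ.2) = x.1 - x.2 + (δ.1 - δ.2) by ring, div_mul_div_comm, one_mul]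
  refine div_le_div_of_nonneg_left (sq_nonneg _) (by positivity) ?_
  calc Real.cosh (x.1 + δ.1) ^ 2 * Real.cosh (x.2 + δ.2) ^ 2
      ≤ (Real.exp |δ.1| * Real.cosh x.1) ^ 2 * (Real.exp |δ.2| * Real.cosh x.2) ^ 2 := by gcongr
    _ = _ := by ring

/-- A single shift can bring the two points together, so only the symmetrized bound can hold. In the
form `sinh²(d)/(cosh² cosh²)`, the denominators cost the exponential factor, and `sinh²(d + ε) +
sinh²(d - ε) = 2(sinh²d cosh²ε + cosh²d sinh²ε) ≥ 2 sinh²d`. -/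
lemma gap_symm_ge (x δ : ℝ × ℝ) :
    2 * (Real.exp (-(2 * (|δ.1| + |δ.2|))) * gap x) ≤ gap (x + δ) + gap (x + -δ) := by
  have h1 := gap_add_ge x δ
  have h2 := gap_add_ge x (-δ)
  simp only [Prod.fst_neg, Prod.snd_neg, abs_neg] at h2
  refine le_trans ?_ (add_le_add h1 h2)
  rw [← mul_add, ← add_div, mul_left_comm, gap_eq x, ← mul_div_assoc 2]
  gcongr
  set d := x.1 - x.2
  set ε := δ.1 - δ.2 with hε
  rw [show -δ.1 - -δ.2 = -ε by rw [hε]; ring, Real.sinh_add, Real.sinh_add, Real.cosh_neg,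
    Real.sinh_neg]
  have := Real.cosh_sq_sub_sinh_sq ε
  have h3 : Real.cosh ε ^ 2 = 1 + Real.sinh ε ^ 2 := by linarith
  nlinarith [sq_nonneg (Real.sinh d * Real.sinh ε), sq_nonneg (Real.cosh d * Real.sinh ε),
    congrArg (fun z => Real.sinh d ^ 2 * z) h3]

/-- The smoothed gap controls the gap itself. -/
lemma gap_le_heat {t : ℝ} (ht0 : 0 ≤ t) (ht1 : t ≤ 1) (x : ℝ × ℝ) {v V : ℝ} (hv : v ≤ V) :
    gap x ≤ Real.exp (4 * Real.sqrt V) * heat t gap x v := by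
  set r := Real.sqrt v with hr
  have hr0 : 0 ≤ r := Real.sqrt_nonneg v
  have H := hasHess_gap
  have c := H.grad.continuous
  obtain ⟨-, -, m1, m2, -⟩ := gaussPair_moments ht0 ht1
  have hsymm : heat t gap x v = ∫ p, gap (x + -(r • p)) ∂gaussPair t := by
    rw [heat, ← integral_gaussPair_neg ht0 ht1 (by fun_prop)]
    simp only [smul_neg]
    rfl
  have i1 : Integrable (fun p => gap (x + r • p)) (gaussPair t) := integrable_heat c H.growth x v
  have i2 : Integrable (fun p => gap (x + -(r • p))) (gaussPair t) := by
    have := (H.growth.comp_affine x (-r)).integrable_gauss (t := t) (by fun_prop)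
    simpa only [neg_smul] using this
  have s1 : Integrable (fun p : ℝ × ℝ => p.1 ^ 2) (gaussPair t) := by
    simpa only [pow_two] using (ExpGrowth.fst.mul ExpGrowth.fst).integrable_gauss (by fun_prop)
  have s2 : Integrable (fun p : ℝ × ℝ => p.2 ^ 2) (gaussPair t) := by
    simpa only [pow_two] using (ExpGrowth.snd.mul ExpGrowth.snd).integrable_gauss (by fun_prop)
  -- From `2|a| ≤ 1 + a²`, the exponent in `gap_symm_ge` is at most `r(2 + |p|²)`, of mean `4r`. The
  -- exponential is replaced by its tangent at that mean, so that only second moments are needed: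
  -- `|p|²` has mean `2`, and `1 + 2r - r|p|²` averages to `1`.
  have pt : ∀ p : ℝ × ℝ, 2 * (Real.exp (-(4 * r)) * gap x) * (1 + 2 * r)
      - 2 * (Real.exp (-(4 * r)) * gap x) * r * (p.1 ^ 2 + p.2 ^ 2) ≤
      gap (x + r • p) + gap (x + -(r • p)) := by
    intro p
    refine le_trans ?_ (gap_symm_ge x (r • p))
    have habs : ∀ a : ℝ, 2 * |a| ≤ 1 + a ^ 2 := fun a => by
      nlinarith [sq_nonneg (|a| - 1), sq_abs a]
    have u : 2 * (|(r • p).1| + |(r • p).2|) ≤ r * (2 + p.1 ^ 2 + p.2 ^ 2) := by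
      simp only [Prod.smul_fst, Prod.smul_snd, smul_eq_mul, abs_mul, abs_of_nonneg hr0]
      nlinarith [mul_le_mul_of_nonneg_left (habs p.1) hr0,
        mul_le_mul_of_nonneg_left (habs p.2) hr0]
    have E : Real.exp (-(4 * r)) * (1 + 2 * r - r * (p.1 ^ 2 + p.2 ^ 2)) ≤
        Real.exp (-(2 * (|(r • p).1| + |(r • p).2|))) := by
      calc Real.exp (-(4 * r)) * (1 + 2 * r - r * (p.1 ^ 2 + p.2 ^ 2))
          ≤ Real.exp (-(4 * r)) * Real.exp (2 * r - r * (p.1 ^ 2 + p.2 ^ 2)) := by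
            gcongr
            linarith [Real.add_one_le_exp (2 * r - r * (p.1 ^ 2 + p.2 ^ 2))]
        _ ≤ _ := by
            rw [← Real.exp_add]
            exact Real.exp_le_exp.2 (by linarith)
    have := mul_le_mul_of_nonneg_right E (gap_nonneg x)
    linarith
  have s3 : Integrable (fun p : ℝ × ℝ => p.1 ^ 2 + p.2 ^ 2) (gaussPair t) := s1.add s2
  have key := integral_mono ((integrable_const _).sub (s3.const_mul _)) (i1.add i2) pt
  simp only [Pi.add_apply, Pi.sub_apply] at key
  rw [integral_sub (integrable_const _) (s3.const_mul _),
    integral_const_mul (2 * (Real.exp (-(4 * r)) * gap x) * r), integral_const, probReal_univ, one_smul, integral_add i1 i2, ← hsymm,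
    integral_add s1 s2, m1, m2] at key
  change _ ≤ heat t gap x v + _ at key
  have k2 : Real.exp (-(4 * r)) * gap x ≤ heat t gap x v := by linarith
  have k3 := mul_le_mul_of_nonneg_left k2 (Real.exp_pos (4 * r)).le
  rw [← mul_assoc, ← Real.exp_add, add_neg_cancel, Real.exp_zero, one_mul] at k3
  refine k3.trans (mul_le_mul_of_nonneg_right (Real.exp_le_exp.2 ?_) (heat_gap_bounds t x v).1)
  have := Real.sqrt_le_sqrt hv
  linarith

/-! ### Building flows from `T` and the smoothed gaps -/

section Closure

variable {w : ℝ} {V V₁ V₂ Vs V₁₁ V₁₂ V₂₂ V' V₁' V₂' Vs' V₁₁' V₁₂' V₂₂' : ℝ × ℝ → ℝ → ℝ}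

lemma HasGrad.add {f f₁ f₂ g g₁ g₂ : ℝ × ℝ → ℝ} (hf : HasGrad f f₁ f₂) (hg : HasGrad g g₁ g₂) :
    HasGrad (fun p => f p + g p) (fun p => f₁ p + g₁ p) (fun p => f₂ p + g₂ p) := fun p => by
  refine ((hf p).add (hg p)).congr_fderiv (ContinuousLinearMap.ext fun v => ?_)
  simp
  ring

lemma HasGrad.const_mul {f f₁ f₂ : ℝ × ℝ → ℝ} (hf : HasGrad f f₁ f₂) (a : ℝ) :
    HasGrad (fun p => a * f p) (fun p => a * f₁ p) (fun p => a * f₂ p) := fun p => by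
  refine ((hf p).const_mul a).congr_fderiv (ContinuousLinearMap.ext fun v => ?_)
  simp
  ring

lemma HasFlow.add (H : HasFlow w V V₁ V₂ Vs V₁₁ V₁₂ V₂₂)
    (H' : HasFlow w V' V₁' V₂' Vs' V₁₁' V₁₂' V₂₂') :
    HasFlow w (fun x s => V x s + V' x s) (fun x s => V₁ x s + V₁' x s)
      (fun x s => V₂ x s + V₂' x s) (fun x s => Vs x s + Vs' x s)
      (fun x s => V₁₁ x s + V₁₁' x s) (fun x s => V₁₂ x s + V₁₂' x s)
      (fun x s => V₂₂ x s + V₂₂' x s) where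
  continuous := H.continuous.add H'.continuous
  hasFDerivAt s hs x := by
    refine ((H.hasFDerivAt s hs x).add (H'.hasFDerivAt s hs x)).congr_fderiv
      (ContinuousLinearMap.ext fun v => ?_)
    simp
    ring
  grad₁ s hs := (H.grad₁ s hs).add (H'.grad₁ s hs)
  grad₂ s hs := (H.grad₂ s hs).add (H'.grad₂ s hs)
  continuous_time s hs := (H.continuous_time s hs).add (H'.continuous_time s hs)
  continuous₁₁ s hs := (H.continuous₁₁ s hs).add (H'.continuous₁₁ s hs)
  continuous₁₂ s hs := (H.continuous₁₂ s hs).add (H'.continuous₁₂ s hs)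
  continuous₂₂ s hs := (H.continuous₂₂ s hs).add (H'.continuous₂₂ s hs)

lemma HasFlow.zero (w : ℝ) : HasFlow w (fun _ _ => 0) (fun _ _ => 0) (fun _ _ => 0)
    (fun _ _ => 0) (fun _ _ => 0) (fun _ _ => 0) (fun _ _ => 0) where
  continuous := continuous_const
  hasFDerivAt s hs x := (hasFDerivAt_const (0 : ℝ) _).congr_fderiv
    (ContinuousLinearMap.ext fun v => by simp)
  grad₁ s hs p := (hasFDerivAt_const (0 : ℝ) _).congr_fderiv
    (ContinuousLinearMap.ext fun v => by simp)
  grad₂ s hs p := (hasFDerivAt_const (0 : ℝ) _).congr_fderiv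
    (ContinuousLinearMap.ext fun v => by simp)
  continuous_time s hs := continuous_const
  continuous₁₁ s hs := continuous_const
  continuous₁₂ s hs := continuous_const
  continuous₂₂ s hs := continuous_const

lemma HasFlow.time_mul (H : HasFlow w V V₁ V₂ Vs V₁₁ V₁₂ V₂₂) {b : ℝ → ℝ} {q : ℝ}
    (hb : ∀ s, HasDerivAt b q s) :
    HasFlow w (fun x s => b s * V x s) (fun x s => b s * V₁ x s) (fun x s => b s * V₂ x s)
      (fun x s => q * V x s + b s * Vs x s) (fun x s => b s * V₁₁ x s)
      (fun x s => b s * V₁₂ x s) (fun x s => b s * V₂₂ x s) where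
  continuous := by
    have hbc : Continuous b := continuous_iff_continuousAt.2 fun s => (hb s).continuousAt
    exact (hbc.comp continuous_snd).mul H.continuous
  hasFDerivAt s hs x := by
    have h1 : HasFDerivAt (fun q : (ℝ × ℝ) × ℝ => b q.2)
        (q • ContinuousLinearMap.snd ℝ (ℝ × ℝ) ℝ) (x, s) :=
      (hb s).comp_hasFDerivAt (x, s) hasFDerivAt_snd
    refine (h1.mul (H.hasFDerivAt s hs x)).congr_fderiv
      (ContinuousLinearMap.ext fun v => ?_)
    simp
    ring
  grad₁ s hs := (H.grad₁ s hs).const_mul _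
  grad₂ s hs := (H.grad₂ s hs).const_mul _
  continuous_time s hs := (continuous_const.mul (H.grad hs).continuous).add
    (continuous_const.mul (H.continuous_time s hs))
  continuous₁₁ s hs := continuous_const.mul (H.continuous₁₁ s hs)
  continuous₁₂ s hs := continuous_const.mul (H.continuous₁₂ s hs)
  continuous₂₂ s hs := continuous_const.mul (H.continuous₂₂ s hs)

lemma HasFlow.sum {ι : Type*} (S : Finset ι) {V V₁ V₂ Vs V₁₁ V₁₂ V₂₂ : ι → ℝ × ℝ → ℝ → ℝ}
    (H : ∀ i, HasFlow w (V i) (V₁ i) (V₂ i) (Vs i) (V₁₁ i) (V₁₂ i) (V₂₂ i)) :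
    HasFlow w (fun x s => ∑ i ∈ S, V i x s) (fun x s => ∑ i ∈ S, V₁ i x s)
      (fun x s => ∑ i ∈ S, V₂ i x s) (fun x s => ∑ i ∈ S, Vs i x s)
      (fun x s => ∑ i ∈ S, V₁₁ i x s) (fun x s => ∑ i ∈ S, V₁₂ i x s)
      (fun x s => ∑ i ∈ S, V₂₂ i x s) := by
  classical
  induction S using Finset.induction_on with
  | empty => simpa using HasFlow.zero w
  | insert a S ha ih =>
    simp only [Finset.sum_insert ha]
    exact (H a).add ih

end Closure

lemma IsLogHeatFlow.hasFlow_fst {m wmax w : ℝ} {T T₁ T₂ : ℝ → ℝ → ℝ}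
    (H : IsLogHeatFlow m wmax T T₁ T₂) (hw : w ≤ wmax) :
    HasFlow w (fun x s => T x.1 s) (fun x s => T₁ x.1 s) (fun _ _ => 0)
      (fun x s => (T₂ x.1 s + m * T₁ x.1 s ^ 2) / 2) (fun x s => T₂ x.1 s) (fun _ _ => 0)
      (fun _ _ => 0) := by
  have mem : ∀ {s}, s ∈ Set.Ioo 0 w → s ∈ Set.Ioo 0 wmax := fun hs => ⟨hs.1, hs.2.trans_le hw⟩
  have mem' : ∀ {s}, s ∈ Set.Ioo 0 w → s ∈ Set.Icc 0 wmax := fun hs =>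
    ⟨hs.1.le, (hs.2.trans_le hw).le⟩
  have c1 : ∀ s ∈ Set.Ioo 0 w, Continuous (T₁ · s) := fun s hs =>
    continuous_iff_continuousAt.2 fun x => (H.hasDerivAt₁ s (mem' hs) x).continuousAt
  refine ⟨?_, fun s hs x => ?_, fun s hs x => ?_, fun s hs => ?_, fun s hs => ?_, fun s hs => ?_,
    fun s hs => continuous_const, fun s hs => continuous_const⟩
  · exact H.continuous.comp (f := fun q : (ℝ × ℝ) × ℝ => (q.1.1, q.2)) (by fun_prop)
  · have e : HasFDerivAt (fun q : (ℝ × ℝ) × ℝ => (q.1.1, q.2))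
        (((ContinuousLinearMap.fst ℝ ℝ ℝ).comp (ContinuousLinearMap.fst ℝ (ℝ × ℝ) ℝ)).prod
          (ContinuousLinearMap.snd ℝ (ℝ × ℝ) ℝ)) (x, s) :=
      ContinuousLinearMap.hasFDerivAt (((ContinuousLinearMap.fst ℝ ℝ ℝ).comp
        (ContinuousLinearMap.fst ℝ (ℝ × ℝ) ℝ)).prod (ContinuousLinearMap.snd ℝ (ℝ × ℝ) ℝ))
    refine ((H.hasFDerivAt s (mem hs) x.1).comp (x, s) e).congr_fderiv
      (ContinuousLinearMap.ext fun v => ?_)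
    simp
  · refine ((H.hasDerivAt₁ s (mem' hs) x.1).comp_hasFDerivAt x hasFDerivAt_fst).congr_fderiv
      (ContinuousLinearMap.ext fun v => ?_)
    simp
  · exact (HasFlow.zero w).grad₁ s hs
  · have := c1 s hs
    have := H.continuous₂ s (mem' hs)
    have h1 : Continuous (fun y : ℝ => (T₂ y s + m * T₁ y s ^ 2) / 2) := by fun_prop
    exact h1.comp continuous_fst
  · exact (H.continuous₂ s (mem' hs)).comp continuous_fst

lemma HasFlow.swap {w : ℝ} {V V₁ V₂ Vs V₁₁ V₁₂ V₂₂ : ℝ × ℝ → ℝ → ℝ}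
    (H : HasFlow w V V₁ V₂ Vs V₁₁ V₁₂ V₂₂) :
    HasFlow w (fun x s => V x.swap s) (fun x s => V₂ x.swap s) (fun x s => V₁ x.swap s)
      (fun x s => Vs x.swap s) (fun x s => V₂₂ x.swap s) (fun x s => V₁₂ x.swap s)
      (fun x s => V₁₁ x.swap s) := by
  have e : ∀ x, HasFDerivAt (fun p : ℝ × ℝ => p.swap)
      ((ContinuousLinearMap.snd ℝ ℝ ℝ).prod (ContinuousLinearMap.fst ℝ ℝ ℝ)) x := fun x =>
    ContinuousLinearMap.hasFDerivAt
      ((ContinuousLinearMap.snd ℝ ℝ ℝ).prod (ContinuousLinearMap.fst ℝ ℝ ℝ))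
  have e' : ∀ q, HasFDerivAt (fun q : (ℝ × ℝ) × ℝ => (q.1.swap, q.2))
      ((((ContinuousLinearMap.snd ℝ ℝ ℝ).prod (ContinuousLinearMap.fst ℝ ℝ ℝ)).comp
        (ContinuousLinearMap.fst ℝ (ℝ × ℝ) ℝ)).prod (ContinuousLinearMap.snd ℝ (ℝ × ℝ) ℝ)) q :=
    fun q => ContinuousLinearMap.hasFDerivAt
      ((((ContinuousLinearMap.snd ℝ ℝ ℝ).prod (ContinuousLinearMap.fst ℝ ℝ ℝ)).comp
        (ContinuousLinearMap.fst ℝ (ℝ × ℝ) ℝ)).prod (ContinuousLinearMap.snd ℝ (ℝ × ℝ) ℝ))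
  refine ⟨?_, fun s hs x => ?_, fun s hs x => ?_, fun s hs x => ?_,
    fun s hs => (H.continuous_time s hs).comp continuous_swap,
    fun s hs => (H.continuous₂₂ s hs).comp continuous_swap,
    fun s hs => (H.continuous₁₂ s hs).comp continuous_swap,
    fun s hs => (H.continuous₁₁ s hs).comp continuous_swap⟩
  · exact H.continuous.comp (f := fun q : (ℝ × ℝ) × ℝ => (q.1.swap, q.2)) (by fun_prop)
  · refine ((H.hasFDerivAt s hs x.swap).comp (x, s) (e' (x, s))).congr_fderiv
      (ContinuousLinearMap.ext fun v => ?_)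
    simp
    ring
  · refine ((H.grad₂ s hs x.swap).comp x (e x)).congr_fderiv (ContinuousLinearMap.ext fun v => ?_)
    simp
    ring
  · refine ((H.grad₁ s hs x.swap).comp x (e x)).congr_fderiv (ContinuousLinearMap.ext fun v => ?_)
    simp
    ring

/-- The two alternatives are the clocks used for `n = 0` (frozen at `0`) and `n ≥ 1` (running from
`wₙ`). The frozen one needs separate treatment because the heat equation is available only at
positive times. -/
lemma hasFlow_gap {t : ℝ} (ht0 : 0 ≤ t) (ht1 : t ≤ 1) (w : ℝ) {b c : ℝ}
    (h : b = 0 ∧ c = 0 ∨ b = 1 ∧ 0 ≤ c) :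
    HasFlow w (fun x s => heat t gap x (b * s + c)) (fun x s => heat t gap₁ x (b * s + c))
      (fun x s => heat t gap₂ x (b * s + c))
      (fun x s => b * ((heat t gap₁₁ x (b * s + c) + 2 * t * heat t gap₁₂ x (b * s + c)
        + heat t gap₂₂ x (b * s + c)) / 2))
      (fun x s => heat t gap₁₁ x (b * s + c)) (fun x s => heat t gap₁₂ x (b * s + c))
      (fun x s => heat t gap₂₂ x (b * s + c)) := by
  have H := hasHess_gap
  have c11 := fun s => continuous_heat_left (t := t) H.continuous₁₁ H.growth₁₁ s
  have c12 := fun s => continuous_heat_left (t := t) H.continuous₁₂ H.growth₁₂ s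
  have c22 := fun s => continuous_heat_left (t := t) H.continuous₂₂ H.growth₂₂ s
  refine ⟨?_, fun s hs x => ?_, fun s hs => ?_, fun s hs => ?_, fun s hs => ?_,
    fun s hs => c11 _, fun s hs => c12 _, fun s hs => c22 _⟩
  · exact (continuous_heat (t := t) H.grad.continuous H.growth).comp
      (f := fun q : (ℝ × ℝ) × ℝ => (q.1, b * q.2 + c)) (by fun_prop)
  · rcases h with ⟨rfl, rfl⟩ | ⟨rfl, hc⟩
    · simp only [zero_mul, add_zero, heat_zero]
      refine (HasFDerivAt.comp (x, s) (f := (Prod.fst : (ℝ × ℝ) × ℝ → ℝ × ℝ)) (H.grad x)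
        hasFDerivAt_fst).congr_fderiv
        (ContinuousLinearMap.ext fun v => ?_)
      simp
    · simp only [one_mul]
      have e : HasFDerivAt (fun q : (ℝ × ℝ) × ℝ => (q.1, q.2 + c))
          (ContinuousLinearMap.id ℝ ((ℝ × ℝ) × ℝ)) (x, s) := by
        have e0 : (fun q : (ℝ × ℝ) × ℝ => (q.1, q.2 + c)) = fun q => id q + ((0, 0), c) := by
          ext q <;> simp
        rw [e0]
        exact (hasFDerivAt_id (x, s)).add_const ((0, 0), c)
      exact (H.hasFDerivAt_heat ht0 ht1 x (add_pos_of_pos_of_nonneg hs.1 hc)).comp (x, s) e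
  · exact H.grad₁.heat H.continuous₁₁ H.continuous₁₂ H.growth₁ H.growth₁₁ H.growth₁₂ _
  · exact H.grad₂.heat H.continuous₁₂ H.continuous₂₂ H.growth₂ H.growth₁₂ H.growth₂₂ _
  · have := c11 (b * s + c)
    have := c12 (b * s + c)
    have := c22 (b * s + c)
    fun_prop

/-! ### The pointwise supersolution inequality -/

lemma abs_sum_mul_le {ι : Type*} [Fintype ι] {b f c : ι → ℝ} {M : ℝ} (hb : ∀ i, |b i| ≤ c i)
    (hf : ∀ i, |f i| ≤ M) : |∑ i, b i * f i| ≤ (∑ i, c i) * M := by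
  refine (Finset.abs_sum_le_sum_abs _ _).trans ?_
  rw [Finset.sum_mul]
  refine Finset.sum_le_sum fun i _ => ?_
  rw [abs_mul]
  exact mul_le_mul (hb i) (hf i) (abs_nonneg _) ((abs_nonneg _).trans (hb i))

/-- The cross term between the gradients of `T` and of a smoothed gap `F`. -/
lemma cross_term_ge {t C R a₁ a₂ F₀ F F₁ F₂ : ℝ} (ht0 : 0 ≤ t) (ht1 : t ≤ 1) (hC : 0 < C)
    (ha₁ : |a₁| ≤ 1) (hF₁ : F₁ ^ 2 ≤ 4 * F) (hF₂ : F₂ ^ 2 ≤ 4 * F) (hF₁₂ : |F₁ + F₂| ≤ 4 * F)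
    (hR : F₀ ≤ R * F) (ha : (a₁ - a₂) ^ 2 ≤ C ^ 2 * F₀) :
    -(a₁ * F₁ + a₂ * F₂ + t * (a₁ * F₂ + a₂ * F₁)) ≤ (8 + C * (R + 4)) * F := by
  have h1 : |a₁ * (F₁ + F₂)| ≤ 4 * F := by
    rw [abs_mul]
    calc |a₁| * |F₁ + F₂| ≤ 1 * |F₁ + F₂| := by gcongr
      _ ≤ 4 * F := by linarith
  -- Young's inequality with weight `C`: both `(a₁ - a₂)²` and `C²G²` are at most a multiple of
  -- `C²F`.
  have h2 : ∀ G : ℝ, G ^ 2 ≤ 4 * F → |(a₂ - a₁) * G| ≤ C * (R + 4) * F / 2 := by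
    intro G hG
    have e1 : 2 * C * |(a₂ - a₁) * G| ≤ (a₁ - a₂) ^ 2 + C ^ 2 * G ^ 2 := by
      rw [abs_mul]
      nlinarith [sq_nonneg (|a₂ - a₁| - C * |G|), sq_abs (a₂ - a₁), sq_abs G]
    have e2 : C ^ 2 * G ^ 2 ≤ C ^ 2 * (4 * F) := by gcongr
    have e3 : C ^ 2 * F₀ ≤ C ^ 2 * (R * F) := by gcongr
    have e4 : C * (2 * |(a₂ - a₁) * G|) ≤ C * (C * (R + 4) * F) := by nlinarith
    linarith [le_of_mul_le_mul_left e4 hC]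
  have k1 := abs_le.1 h1
  have k2 := abs_le.1 (h2 F₁ hF₁)
  have k3 := abs_le.1 (h2 F₂ hF₂)
  -- Writing `a₂ = a₁ + (a₂ - a₁)` leaves only the diagonal derivative `F₁ + F₂` and products with
  -- the small factor `a₂ - a₁`.
  have key : -(a₁ * F₁ + a₂ * F₂ + t * (a₁ * F₂ + a₂ * F₁)) =
      -(a₁ * (F₁ + F₂)) + -((a₂ - a₁) * F₂)
        + t * (-(a₁ * (F₁ + F₂)) + -((a₂ - a₁) * F₁)) := by ring
  have k4 : t * (-(a₁ * (F₁ + F₂)) + -((a₂ - a₁) * F₁)) ≤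
      1 * (4 * F + C * (R + 4) * F / 2) := by
    have n0 : 0 ≤ 4 * F + C * (R + 4) * F / 2 := by
      linarith [abs_nonneg (a₁ * (F₁ + F₂)), abs_nonneg ((a₂ - a₁) * F₁), h2 F₁ hF₁]
    calc _ ≤ t * (4 * F + C * (R + 4) * F / 2) := by
          refine mul_le_mul_of_nonneg_left ?_ ht0
          linarith
      _ ≤ _ := by gcongr
  rw [key]
  linarith

/-- Cauchy–Schwarz with weights `b`. The factor `∑ b` is the source of `4 ∑ αᵢ` in the final
constant. -/
lemma sq_sum_mul_le {ι : Type*} [Fintype ι] {b f F : ι → ℝ} (hb : ∀ i, 0 ≤ b i)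
    (hf : ∀ i, f i ^ 2 ≤ 4 * F i) :
    (∑ i, b i * f i) ^ 2 ≤ 4 * (∑ i, b i) * ∑ i, b i * F i := by
  have h := Finset.sum_sq_le_sum_mul_sum_of_sq_le_mul Finset.univ (r := fun i => b i * f i)
    (f := b) (g := fun i => b i * f i ^ 2) (fun i _ => hb i)
    (fun i _ => mul_nonneg (hb i) (sq_nonneg _)) (fun i _ => le_of_eq (by ring))
  refine h.trans ?_
  have h2 : ∑ i, b i * f i ^ 2 ≤ 4 * ∑ i, b i * F i := by
    rw [Finset.mul_sum]
    refine Finset.sum_le_sum fun i _ => ?_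
    linarith [mul_le_mul_of_nonneg_left (hf i) (hb i)]
  have h3 : 0 ≤ ∑ i, b i := Finset.sum_nonneg fun i _ => hb i
  linarith [mul_le_mul_of_nonneg_left h2 h3]

lemma sum_deltaZero_mul {l : ℕ} (f : Fin (l + 1) → ℝ) : ∑ n, deltaZero n * f n = f 0 := by
  simp [deltaZero]

/-- The constant `K₁` of the main theorem. -/
def couplingConst (C₁ L : ℝ) : ℝ :=
  2 + (8 + C₁ * (Real.exp (4 * Real.sqrt (L + 1)) + 4)) + 1 / C₁ ^ 2

lemma two_le_couplingConst {C₁ : ℝ} (hC₁ : 0 < C₁) (L : ℝ) : 2 ≤ couplingConst C₁ L := by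
  have : 0 ≤ (8 + C₁ * (Real.exp (4 * Real.sqrt (L + 1)) + 4)) + 1 / C₁ ^ 2 := by positivity
  unfold couplingConst
  linarith

/-- The pointwise inequality behind the supersolution property. -/
lemma supersolution_ineq {l : ℕ} {t m C₁ L s C κ a₁ a₂ L₀ : ℝ} {α b F F₁ F₂ : Fin (l + 1) → ℝ}
    (ht0 : 0 ≤ t) (ht1 : t ≤ 1) (hm0 : 0 ≤ m) (hm1 : m ≤ 1) (hC₁ : 0 < C₁)
    (hα : ∀ n, 0 ≤ α n) (hs : 0 ≤ s) (hC : C = 4 * (∑ n, α n) + couplingConst C₁ L)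
    (hsC : s * C ≤ 1 / 2) (hκ : κ = t / (2 * (1 + t) * C₁ ^ 2) / 2 * m)
    (hb : ∀ n, b n = α n * (1 - s * C) + κ * s * deltaZero n)
    (ha₁ : |a₁| ≤ 1) (hF0 : ∀ n, 0 ≤ F n)
    (hF₁ : ∀ n, F₁ n ^ 2 ≤ 4 * F n) (hF₂ : ∀ n, F₂ n ^ 2 ≤ 4 * F n)
    (hF₁₂ : ∀ n, |F₁ n + F₂ n| ≤ 4 * F n)
    (hR : ∀ n, F 0 ≤ Real.exp (4 * Real.sqrt (L + 1)) * F n)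
    (ha : (a₁ - a₂) ^ 2 ≤ C₁ ^ 2 * F 0) (ha' : F 0 ≤ C₁ ^ 2 * (a₁ - a₂) ^ 2)
    (hL₀ : -4 * F 0 ≤ L₀) :
    m / (1 + t) * ((a₁ - ∑ n, b n * F₁ n) ^ 2
        + 2 * t * ((a₁ - ∑ n, b n * F₁ n) * (a₂ - ∑ n, b n * F₂ n))
        + (a₂ - ∑ n, b n * F₂ n) ^ 2) / 2 ≤
      m * (a₁ ^ 2 + a₂ ^ 2) / 2 + C * ∑ n, α n * F n - κ * F 0 + b 0 * L₀ / 2 := by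
  have h1t : 0 < 1 + t := by linarith
  have hSα : 0 ≤ ∑ n, α n := Finset.sum_nonneg fun n _ => hα n
  have hC2 : 2 ≤ C := by linarith [two_le_couplingConst hC₁ L]
  have hs1 : s ≤ 1 := by
    linarith only [mul_le_mul_of_nonneg_left hC2 hs, hsC]
  have hκ0 : 0 ≤ κ := by rw [hκ]; positivity
  have hδ : ∀ n : Fin (l + 1), 0 ≤ deltaZero n := fun n => by unfold deltaZero; split <;> norm_num
  have hb0 : ∀ n, 0 ≤ b n := fun n => by
    rw [hb]
    exact add_nonneg (mul_nonneg (hα n) (by linarith)) (mul_nonneg (by positivity) (hδ n))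
  set c := 8 + C₁ * (Real.exp (4 * Real.sqrt (L + 1)) + 4) with hc
  have hc0 : 0 ≤ c := by positivity
  set Q := ∑ n, b n * F n with hQ
  set G₁ := ∑ n, b n * F₁ n with hG₁
  set G₂ := ∑ n, b n * F₂ n with hG₂
  set S := ∑ n, b n with hS
  set SF := ∑ n, α n * F n with hSF
  have hQ0 : 0 ≤ Q := Finset.sum_nonneg fun n _ => mul_nonneg (hb0 n) (hF0 n)
  have hS0 : 0 ≤ S := Finset.sum_nonneg fun n _ => hb0 n
  have hSF0 : 0 ≤ SF := Finset.sum_nonneg fun n _ => mul_nonneg (hα n) (hF0 n)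
  have hQeq : Q = (1 - s * C) * SF + κ * s * F 0 := by
    rw [hQ, hSF, Finset.mul_sum, ← sum_deltaZero_mul F, Finset.mul_sum, ← Finset.sum_add_distrib]
    refine Finset.sum_congr rfl fun n _ => ?_
    rw [hb]; ring
  have hSeq : S = (1 - s * C) * (∑ n, α n) + κ * s := by
    have := sum_deltaZero_mul (l := l) (fun _ => 1)
    simp only [mul_one] at this
    rw [hS, Finset.sum_congr rfl fun n _ => hb n, Finset.sum_add_distrib, ← Finset.sum_mul,
      ← Finset.mul_sum, this]
    ring
  have cross : -(a₁ * G₁ + a₂ * G₂ + t * (a₁ * G₂ + a₂ * G₁)) ≤ c * Q := by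
    have e : -(a₁ * G₁ + a₂ * G₂ + t * (a₁ * G₂ + a₂ * G₁)) =
        ∑ n, b n * -(a₁ * F₁ n + a₂ * F₂ n + t * (a₁ * F₂ n + a₂ * F₁ n)) := by
      rw [hG₁, hG₂]
      simp only [Finset.mul_sum, ← Finset.sum_add_distrib, ← Finset.sum_neg_distrib]
      exact Finset.sum_congr rfl fun n _ => by ring
    rw [e, hQ, Finset.mul_sum]
    refine Finset.sum_le_sum fun n _ => ?_
    have := mul_le_mul_of_nonneg_left (cross_term_ge ht0 ht1 hC₁ ha₁ (hF₁ n) (hF₂ n) (hF₁₂ n)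
      (hR n) ha) (hb0 n)
    linarith
  have q1 : G₁ ^ 2 ≤ 4 * S * Q := sq_sum_mul_le hb0 hF₁
  have q2 : G₂ ^ 2 ≤ 4 * S * Q := sq_sum_mul_le hb0 hF₂
  have hb0F : b 0 * F 0 ≤ Q :=
    Finset.single_le_sum (f := fun n => b n * F n)
      (fun n _ => mul_nonneg (hb0 n) (hF0 n)) (Finset.mem_univ 0)
  have hm' : 0 ≤ m / (1 + t) := by positivity
  have hm'1 : m / (1 + t) ≤ 1 := by
    rw [div_le_one h1t]; linarith
  -- quadratic form in the gradient
  have quad : (a₁ - G₁) ^ 2 + 2 * t * ((a₁ - G₁) * (a₂ - G₂)) + (a₂ - G₂) ^ 2 ≤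
      (1 + t) * (a₁ ^ 2 + a₂ ^ 2) - t * (a₁ - a₂) ^ 2 + 2 * (c * Q) + (1 + t) * (8 * S * Q) := by
    have e : G₁ ^ 2 + 2 * t * (G₁ * G₂) + G₂ ^ 2 ≤ (1 + t) * (G₁ ^ 2 + G₂ ^ 2) := by
      nlinarith [mul_nonneg ht0 (sq_nonneg (G₁ - G₂))]
    have e' : (1 + t) * (G₁ ^ 2 + G₂ ^ 2) ≤ (1 + t) * (8 * S * Q) := by
      refine mul_le_mul_of_nonneg_left ?_ h1t.le
      linarith
    linarith
  have step1 : m / (1 + t) * ((a₁ - G₁) ^ 2 + 2 * t * ((a₁ - G₁) * (a₂ - G₂))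
      + (a₂ - G₂) ^ 2) / 2 ≤ m * (a₁ ^ 2 + a₂ ^ 2) / 2
        - m * t / (2 * (1 + t)) * (a₁ - a₂) ^ 2 + c * Q + 4 * S * Q := by
    have e := mul_le_mul_of_nonneg_left quad hm'
    have e1 : m / (1 + t) * ((1 + t) * (a₁ ^ 2 + a₂ ^ 2) - t * (a₁ - a₂) ^ 2 + 2 * (c * Q)
        + (1 + t) * (8 * S * Q)) = m * (a₁ ^ 2 + a₂ ^ 2)
        - 2 * (m * t / (2 * (1 + t)) * (a₁ - a₂) ^ 2) + 2 * (m / (1 + t) * (c * Q))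
        + m * (8 * S * Q) := by
      field_simp
    have e2 : m / (1 + t) * (c * Q) ≤ 1 * (c * Q) :=
      mul_le_mul_of_nonneg_right hm'1 (by positivity)
    have e3 : m * (8 * S * Q) ≤ 1 * (8 * S * Q) :=
      mul_le_mul_of_nonneg_right hm1 (by positivity)
    linarith
  -- The gain is worth two copies of `κ F 0`: one gives the `-κ F 0` of the conclusion, the other
  -- pays for `step4`. This fixes the value of `κ`.
  have step2 : 2 * κ * F 0 ≤ m * t / (2 * (1 + t)) * (a₁ - a₂) ^ 2 := by
    have e : m * t / (2 * (1 + t)) * (a₁ - a₂) ^ 2 =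
        2 * κ * (C₁ ^ 2 * (a₁ - a₂) ^ 2) := by
      rw [hκ]; field_simp
    rw [e]
    gcongr
  have hκ1 : 4 * (κ * s) ≤ 1 / C₁ ^ 2 := by
    have e : 4 * κ = (t / (1 + t)) * m * (1 / C₁ ^ 2) := by
      rw [hκ]; field_simp; ring
    have e1 : t / (1 + t) ≤ 1 := by rw [div_le_one h1t]; linarith
    have e2 : (t / (1 + t)) * m * (1 / C₁ ^ 2) ≤ 1 * 1 * (1 / C₁ ^ 2) := by gcongr
    have e3 : κ * s ≤ κ * 1 := by gcongr
    linarith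
  -- Origin of `couplingConst`: `2` for the frozen Laplacian (`step5`), `c` for the cross term, and
  -- `1 / C₁²` for the part `4κs` of `4S`; the rest of `4S` is at most `4 ∑ αₙ`.
  have step3 : (2 + c + 4 * S) * Q ≤ C * Q := by
    refine mul_le_mul_of_nonneg_right ?_ hQ0
    have e : (1 - s * C) * (∑ n, α n) ≤ ∑ n, α n :=
      mul_le_of_le_one_left hSα (by linarith only [mul_nonneg hs (zero_le_two.trans hC2)])
    have e2 : couplingConst C₁ L = 2 + c + 1 / C₁ ^ 2 := rfl
    rw [hC, e2, hSeq]
    linarith only [e, hκ1]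
  -- `Q` is weighted by `b` rather than `α`; the excess `C κ s F 0` is at most `κ F 0` because `s C
  -- ≤ 1/2`.
  have step4 : C * Q ≤ C * SF + κ * F 0 := by
    rw [hQeq]
    have e1 : 0 ≤ C * (s * C) * SF := mul_nonneg (mul_nonneg (by linarith)
      (mul_nonneg hs (by linarith))) hSF0
    have e2 : (s * C) * (κ * F 0) ≤ 1 * (κ * F 0) :=
      mul_le_mul_of_nonneg_right (by linarith) (mul_nonneg hκ0 (hF0 0))
    linarith
  have step5 : -(2 * Q) ≤ b 0 * L₀ / 2 := by
    have := mul_le_mul_of_nonneg_left hL₀ (hb0 0)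
    linarith only [this, hb0F]
  linarith only [step1, step2, step3, step4, step5]

/-! ### The interpolation and the comparison argument -/

section Coupling

variable {m wmax C₁ : ℝ} {A : ℝ → ℝ}

/-- The interpolation between the initial value `A(x₁) + A(x₂) - ∑ αₙ F(x₁, x₂, wₙ)` and the
right-hand side of the main theorem. -/
def couplingFlow (A : ℝ → ℝ) (m t C κ : ℝ) {l : ℕ} (α wseq : Fin (l + 1) → ℝ) (x : ℝ × ℝ)
    (s : ℝ) : ℝ :=
  smoothT A m x.1 s + smoothT A m x.2 s
    + ∑ n, -(α n * (1 - s * C) + κ * s * deltaZero n)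
      * heat t gap x ((1 - deltaZero n) * s + wseq n)

/-- `T(·, s)` is 1-Lipschitz and `T(0, ·)` is continuous on a compact interval. -/
lemma exists_bound_smoothT (hA : ConditionA m wmax C₁ A) (hC₁ : 0 < C₁) (hw0 : 0 ≤ wmax)
    (hm : 0 ≤ m) : ∃ T₀ : ℝ, 0 ≤ T₀ ∧ ∀ s ∈ Set.Icc 0 wmax, ∀ x, |smoothT A m x s| ≤ T₀ + |x| := by
  have hT := hA.isLogHeatFlow hC₁ hw0 hm
  have hc : Continuous (fun s => smoothT A m 0 s) :=
    hT.continuous.comp (f := fun s : ℝ => ((0 : ℝ), s)) (by fun_prop)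
  obtain ⟨T₀, hT₀⟩ := isCompact_Icc.exists_bound_of_continuousOn (s := Set.Icc 0 wmax)
    hc.continuousOn
  refine ⟨T₀, (norm_nonneg _).trans (hT₀ 0 ⟨le_rfl, hw0⟩), fun s hs x => ?_⟩
  have h1 := hT₀ s hs
  have h2 := abs_sub_le_of_abs_hasDerivAt_le (hT.hasDerivAt s hs) (hT.abs_le₁ s hs) x 0
  have h3 := abs_sub_abs_le_abs_sub (smoothT A m x s) (smoothT A m 0 s)
  rw [Real.norm_eq_abs] at h1
  rw [sub_zero] at h2
  linarith

/-- The comparison principle applied to `couplingFlow`. Continuity and linear growth at time `0` are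
recorded as well because they yield the integrability of `Z` and of its exponential. -/
theorem couplingFlow_bound (hA : ConditionA m wmax C₁ A) (hC₁ : 0 < C₁) (hm0 : 0 ≤ m)
    (hm1 : m ≤ 1) {t : ℝ} (ht0 : 0 ≤ t) (ht1 : t ≤ 1) {L : ℝ} {l : ℕ}
    {α wseq : Fin (l + 1) → ℝ} (hα : ∀ n, 0 ≤ α n) {C κ : ℝ}
    (hC : C = 4 * (∑ n, α n) + couplingConst C₁ L)
    (hκ : κ = t / (2 * (1 + t) * C₁ ^ 2) / 2 * m) {w : ℝ} (hw0 : 0 ≤ w) (hw : w ≤ wmax)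
    (hwC : w * C ≤ 1 / 2) (hz : wseq 0 = 0) (hwseq : ∀ n, 0 ≤ wseq n ∧ wseq n ≤ L) :
    Continuous (couplingFlow A m t C κ α wseq · 0) ∧
    (∃ B, 0 ≤ B ∧ ∀ x, |couplingFlow A m t C κ α wseq x 0| ≤ B * (1 + ‖x‖)) ∧
    ∀ x, logExpMean (gaussPair t) (m / (1 + t))
      (fun p => couplingFlow A m t C κ α wseq (x + Real.sqrt w • p) 0) ≤
        couplingFlow A m t C κ α wseq x w := by
  have hT := hA.isLogHeatFlow hC₁ (hw0.trans hw) hm0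
  obtain ⟨T₀, hT₀, hTb⟩ := exists_bound_smoothT hA hC₁ (hw0.trans hw) hm0
  set T := smoothT A m with hTdef
  set T₁ : ℝ → ℝ → ℝ := fun x s => iteratedDeriv 1 (fun x => smoothT A m x s) x
  set T₂ : ℝ → ℝ → ℝ := fun x s => iteratedDeriv 2 (fun x => smoothT A m x s) x
  -- `e n` is the signed coefficient, `q n` its constant time derivative, and `v n` the clock of the
  -- `n`-th gap.
  set e : Fin (l + 1) → ℝ → ℝ := fun n s => -(α n * (1 - s * C) + κ * s * deltaZero n) with he
  set q : Fin (l + 1) → ℝ := fun n => α n * C - κ * deltaZero n with hq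
  set v : Fin (l + 1) → ℝ → ℝ := fun n s => (1 - deltaZero n) * s + wseq n with hv
  have hSα : 0 ≤ ∑ n, α n := Finset.sum_nonneg fun n _ => hα n
  have hC2 : 2 ≤ C := by linarith [two_le_couplingConst hC₁ L]
  have hκ0 : 0 ≤ κ := by rw [hκ]; positivity
  have hδ : ∀ n : Fin (l + 1), deltaZero n = 0 ∨ deltaZero n = 1 := fun n => by
    unfold deltaZero; split <;> simp
  have hδ0 : ∀ n : Fin (l + 1), 0 ≤ deltaZero n := fun n => by
    rcases hδ n with h | h <;> simp [h]
  have hδ1 : ∀ n : Fin (l + 1), deltaZero n ≤ 1 := fun n => by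
    rcases hδ n with h | h <;> simp [h]
  have hδz : deltaZero (0 : Fin (l + 1)) = 1 := if_pos rfl
  have hde : ∀ n s, HasDerivAt (e n) (q n) s := by
    intro n s
    have h1 := ((((hasDerivAt_id s).mul_const C).const_sub 1).const_mul (α n)).add
      (((hasDerivAt_id s).const_mul κ).mul_const (deltaZero n))
    refine h1.neg.congr_deriv ?_
    simp only [hq]
    ring
  have hF : ∀ n, HasFlow w (fun x s => heat t gap x (v n s)) (fun x s => heat t gap₁ x (v n s))
      (fun x s => heat t gap₂ x (v n s))
      (fun x s => (1 - deltaZero n) * ((heat t gap₁₁ x (v n s) + 2 * t * heat t gap₁₂ x (v n s)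
        + heat t gap₂₂ x (v n s)) / 2))
      (fun x s => heat t gap₁₁ x (v n s)) (fun x s => heat t gap₁₂ x (v n s))
      (fun x s => heat t gap₂₂ x (v n s)) := by
    intro n
    refine hasFlow_gap ht0 ht1 w ?_
    by_cases hn : n = 0
    · left; rw [hn, hδz, hz]; simp
    · right; exact ⟨by simp [deltaZero, hn], (hwseq n).1⟩
  have H2 : HasFlow w (fun x s => T x.2 s) (fun _ _ => 0) (fun x s => T₁ x.2 s)
      (fun x s => (T₂ x.2 s + m * T₁ x.2 s ^ 2) / 2) (fun _ _ => 0) (fun _ _ => 0)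
      (fun x s => T₂ x.2 s) := (hT.hasFlow_fst hw).swap
  have HU := ((hT.hasFlow_fst hw).add H2).add
    (HasFlow.sum Finset.univ fun n => (hF n).time_mul (hde n))
  set M := ∑ n, (α n + κ) with hM
  set N := ∑ n, (α n * C + κ) with hN
  have hM0 : 0 ≤ M := Finset.sum_nonneg fun n _ => add_nonneg (hα n) hκ0
  have hN0 : 0 ≤ N := Finset.sum_nonneg fun n _ =>
    add_nonneg (mul_nonneg (hα n) (by linarith)) hκ0
  -- The bound `s ≤ 1`, a consequence of `C ≥ 2`, keeps every clock below `L + 1`, so the constant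
  -- in `gap_le_heat` depends only on `L`.
  have hsb : ∀ s ∈ Set.Icc 0 w, 0 ≤ s * C ∧ s * C ≤ 1 / 2 ∧ s ≤ 1 := by
    intro s hs
    have h1 : s * C ≤ w * C := mul_le_mul_of_nonneg_right hs.2 (by linarith)
    have h2 := mul_le_mul_of_nonneg_left hC2 hs.1
    exact ⟨mul_nonneg hs.1 (by linarith), by linarith, by linarith⟩
  have heb : ∀ s ∈ Set.Icc 0 w, ∀ n, |e n s| ≤ α n + κ := by
    intro s hs n
    obtain ⟨h1, h2, h3⟩ := hsb s hs
    have k1 : 0 ≤ α n * (1 - s * C) := mul_nonneg (hα n) (by linarith)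
    have k2 : α n * (1 - s * C) ≤ α n * 1 := mul_le_mul_of_nonneg_left (by linarith) (hα n)
    have k3 : 0 ≤ κ * s * deltaZero n := mul_nonneg (mul_nonneg hκ0 hs.1) (hδ0 n)
    have k4 : κ * s * deltaZero n ≤ κ * 1 * 1 := by
      have := hδ0 n
      have := hδ1 n
      gcongr
    simp only [he]
    rw [abs_neg, abs_of_nonneg (by linarith)]
    linarith
  have hqb : ∀ n, |q n| ≤ α n * C + κ := by
    intro n
    have k1 : 0 ≤ α n * C := mul_nonneg (hα n) (by linarith)
    have k2 : κ * deltaZero n ≤ κ * 1 := mul_le_mul_of_nonneg_left (hδ1 n) hκ0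
    have k3 : 0 ≤ κ * deltaZero n := mul_nonneg hκ0 (hδ0 n)
    exact abs_le.2 ⟨by linarith, by linarith⟩
  have root : ∀ {y z : ℝ}, y ^ 2 ≤ 4 * z → z ≤ 4 → |y| ≤ 4 := fun {y z} h h' =>
    abs_le_of_sq_le_sq (by linarith) (by norm_num)
  have gb := fun x s => heat_gap_bounds t x s
  have g0 : ∀ x s, |heat t gap x s| ≤ 4 := fun x s => by
    rw [abs_of_nonneg (gb x s).1]; exact (gb x s).2.1
  have g1 : ∀ x s, |heat t gap₁ x s| ≤ 4 := fun x s => root (gb x s).2.2.1 (gb x s).2.1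
  have g2 : ∀ x s, |heat t gap₂ x s| ≤ 4 := fun x s => root (gb x s).2.2.2.1 (gb x s).2.1
  have g11 : ∀ x s, |heat t gap₁₁ x s| ≤ 10 := fun x s => (gb x s).2.2.2.2.2.1
  have g12 : ∀ x s, |heat t gap₁₂ x s| ≤ 10 := fun x s => (gb x s).2.2.2.2.2.2.1
  have g22 : ∀ x s, |heat t gap₂₂ x s| ≤ 10 := fun x s => (gb x s).2.2.2.2.2.2.2
  have gt : ∀ (n : Fin (l + 1)) x s, |(1 - deltaZero n) * ((heat t gap₁₁ x s + 2 * t * heat t gap₁₂ x s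
      + heat t gap₂₂ x s) / 2)| ≤ 20 := by
    intro n x s
    have k1 := abs_le.1 (g11 x s)
    have k2 := abs_le.1 (g22 x s)
    have k3 : |t * heat t gap₁₂ x s| ≤ 1 * 10 := by
      rw [abs_mul, abs_of_nonneg ht0]
      have := g12 x s
      gcongr
    have k4 := abs_le.1 k3
    rw [abs_mul, abs_of_nonneg (sub_nonneg.2 (hδ1 n))]
    have k5 : |(heat t gap₁₁ x s + 2 * t * heat t gap₁₂ x s + heat t gap₂₂ x s) / 2| ≤ 20 :=
      abs_le.2 ⟨by linarith, by linarith⟩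
    calc _ ≤ 1 * |(heat t gap₁₁ x s + 2 * t * heat t gap₁₂ x s + heat t gap₂₂ x s) / 2| := by
          gcongr
          linarith [hδ0 n]
      _ ≤ 20 := by linarith
  have tb : ∀ s ∈ Set.Icc 0 w, ∀ y, |T₁ y s| ≤ 1 ∧ |T₂ y s| ≤ 1 ∧
      |(T₂ y s + m * T₁ y s ^ 2) / 2| ≤ 1 := by
    intro s hs y
    have hs' : s ∈ Set.Icc 0 wmax := ⟨hs.1, hs.2.trans hw⟩
    have k1 := hT.abs_le₁ s hs' y
    have k2 := hT.abs_le₂ s hs' y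
    have k3 : m * T₁ y s ^ 2 ≤ 1 * 1 := by
      have := (sq_le_one_iff_abs_le_one _).2 k1
      gcongr
    have k4 : 0 ≤ m * T₁ y s ^ 2 := by positivity
    have k5 := abs_le.1 k2
    exact ⟨k1, k2, abs_le.2 ⟨by linarith, by linarith⟩⟩
  have mem : ∀ {s}, s ∈ Set.Ioo 0 w → s ∈ Set.Icc 0 w := fun hs => ⟨hs.1.le, hs.2.le⟩
  set B := 2 + 2 * T₀ + 20 * M + 4 * N with hB
  have hB0 : 0 ≤ B := by positivity
  have hU : ∀ x s, couplingFlow A m t C κ α wseq x s =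
      T x.1 s + T x.2 s + ∑ n, e n s * heat t gap x (v n s) := fun x s => rfl
  have bU : ∀ s ∈ Set.Icc 0 w, ∀ x : ℝ × ℝ,
      |T x.1 s + T x.2 s + ∑ n, e n s * heat t gap x (v n s)| ≤ B * (1 + ‖x‖) := by
    intro s hs x
    have hs' : s ∈ Set.Icc 0 wmax := ⟨hs.1, hs.2.trans hw⟩
    have k1 := hTb s hs' x.1
    have k2 := hTb s hs' x.2
    have k3 := abs_sum_mul_le (heb s hs) (fun n => g0 x (v n s))
    have n1 : |x.1| ≤ ‖x‖ := norm_fst_le x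
    have n2 : |x.2| ≤ ‖x‖ := norm_snd_le x
    have n0 := norm_nonneg x
    refine (abs_add_three _ _ _).trans ?_
    have : 2 * ‖x‖ ≤ B * ‖x‖ := mul_le_mul_of_nonneg_right (by
      rw [hB]; linarith [mul_nonneg (zero_le_two : (0 : ℝ) ≤ 2) hT₀]) n0
    rw [mul_add]
    linarith
  refine ⟨?_, ⟨B, hB0, fun x => ?_⟩, fun x => ?_⟩
  · exact HU.continuous.comp (f := fun x => (x, (0 : ℝ))) (by fun_prop)
  · rw [hU]; exact bU 0 ⟨le_rfl, hw0⟩ x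
  have low : ∀ s ∈ Set.Ioo 0 w, ∀ (K y : ℝ) (f : Fin (l + 1) → ℝ), |y| ≤ 1 → 0 ≤ K → K ≤ 20 →
      (∀ n, |f n| ≤ K) → |y + ∑ n, e n s * f n| ≤ B := by
    intro s hs K y f hy hK hK' hf
    have := abs_sum_mul_le (heb s (mem hs)) hf
    have h2 : M * K ≤ M * 20 := mul_le_mul_of_nonneg_left hK' hM0
    refine (abs_add_le _ _).trans ?_
    linarith
  refine HU.logExpMean_le ht0 ht1 (a := m / (1 + t)) hw0 (by positivity) hB0 bU
    (fun s hs y => low s hs 4 _ _ ?_ (by norm_num) (by norm_num) fun n => g1 y _)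
    (fun s hs y => low s hs 4 _ _ ?_ (by norm_num) (by norm_num) fun n => g2 y _)
    (fun s hs y => ?_)
    (fun s hs y => low s hs 10 _ _ ?_ (by norm_num) (by norm_num) fun n => g11 y _)
    (fun s hs y => low s hs 10 _ _ ?_ (by norm_num) (by norm_num) fun n => g12 y _)
    (fun s hs y => low s hs 10 _ _ ?_ (by norm_num) (by norm_num) fun n => g22 y _)
    (fun s hs y => ?_) x
  · rw [add_zero]; exact (tb s (mem hs) _).1
  · rw [zero_add]; exact (tb s (mem hs) _).1
  · have k1 := (tb s (mem hs) y.1).2.2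
    have k2 := (tb s (mem hs) y.2).2.2
    have k3 := abs_sum_mul_le hqb (fun n => g0 y (v n s))
    have k4 := abs_sum_mul_le (heb s (mem hs)) (fun n => gt n y (v n s))
    rw [Finset.sum_add_distrib]
    refine (abs_add_three _ _ _).trans ?_
    have := abs_add_le (∑ n, q n * heat t gap y (v n s)) (∑ n, e n s * ((1 - deltaZero n) *
      ((heat t gap₁₁ y (v n s) + 2 * t * heat t gap₁₂ y (v n s) + heat t gap₂₂ y (v n s)) / 2)))
    linarith
  · rw [add_zero]; exact (tb s (mem hs) _).2.1
  · simp
  · rw [zero_add]; exact (tb s (mem hs) _).2.1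
  · obtain ⟨h1, h2, h3⟩ := hsb s (mem hs)
    have hs' : s ∈ Set.Icc 0 wmax := ⟨hs.1.le, hs.2.le.trans hw⟩
    have hv0 : v 0 s = 0 := by simp [hv, hδz, hz]
    have hvn : ∀ n, v n s ≤ L + 1 := fun n => by
      have : (1 - deltaZero n) * s ≤ 1 * 1 := mul_le_mul (by linarith [hδ0 n]) h3 hs.1.le
        zero_le_one
      simp only [hv]
      linarith [(hwseq n).2]
    have hgap := sq_sub_comparable hC₁ (hT.hasDerivAt₁ s hs')
      (fun y => hA.deriv_two_lower y s hs'.1 hs'.2)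
      (fun y => (hA.deriv_two_upper y s hs'.1 hs'.2).trans (min_le_right _ _)) y.1 y.2
    have hF0 : heat t gap y (v 0 s) = (Real.tanh y.1 - Real.tanh y.2) ^ 2 := by
      rw [hv0, heat_zero]; rfl
    have main := supersolution_ineq (L := L) (b := fun n => -e n s) (a₁ := T₁ y.1 s)
      (a₂ := T₁ y.2 s) (F := fun n => heat t gap y (v n s)) (F₁ := fun n => heat t gap₁ y (v n s))
      (F₂ := fun n => heat t gap₂ y (v n s))
      (L₀ := heat t gap₁₁ y (v 0 s) + 2 * t * heat t gap₁₂ y (v 0 s) + heat t gap₂₂ y (v 0 s))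
      ht0 ht1 hm0 hm1 hC₁ hα hs.1.le hC h2 hκ (fun n => by simp only [he]; ring)
      (tb s (mem hs) _).1 (fun n => (gb y _).1) (fun n => (gb y _).2.2.1)
      (fun n => (gb y _).2.2.2.1) (fun n => (gb y _).2.2.2.2.1)
      (fun n => by rw [hv0, heat_zero]; exact gap_le_heat ht0 ht1 y (hvn n))
      (by rw [hF0]; exact hgap.2) (by rw [hF0]; exact hgap.1)
      (by simp only [hv0, heat_zero]; exact gap_laplacian_ge ht1 y)
    simp only [neg_mul, Finset.sum_neg_distrib, sub_neg_eq_add] at main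
    set lap : Fin (l + 1) → ℝ := fun n =>
      heat t gap₁₁ y (v n s) + 2 * t * heat t gap₁₂ y (v n s) + heat t gap₂₂ y (v n s) with hlap
    have s1 : (∑ n, e n s * heat t gap₁₁ y (v n s)) + 2 * t * (∑ n, e n s * heat t gap₁₂ y (v n s))
        + ∑ n, e n s * heat t gap₂₂ y (v n s) = ∑ n, e n s * lap n := by
      rw [Finset.mul_sum, ← Finset.sum_add_distrib, ← Finset.sum_add_distrib]
      exact Finset.sum_congr rfl fun n _ => by simp only [hlap]; ring
    -- For `n ≥ 1` the moving clock contributes exactly the half-Laplacian required by the equation.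
    -- Only the frozen `n = 0` term is missing, hence the subtraction of `e 0 s * lap 0 / 2`.
    have s2 : ∑ n, (q n * heat t gap y (v n s) + e n s * ((1 - deltaZero n) * (lap n / 2))) =
        C * ∑ n, α n * heat t gap y (v n s) - κ * heat t gap y (v 0 s)
          + (∑ n, e n s * lap n) / 2 - e 0 s * lap 0 / 2 := by
      rw [← sum_deltaZero_mul (fun n => heat t gap y (v n s)),
        ← sum_deltaZero_mul (fun n => e n s * lap n / 2), Finset.mul_sum, Finset.mul_sum,
        Finset.sum_div, ← Finset.sum_sub_distrib, ← Finset.sum_add_distrib,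
        ← Finset.sum_sub_distrib]
      exact Finset.sum_congr rfl fun n _ => by simp only [hq]; ring
    change ((T₂ y.1 s + 0 + ∑ n, e n s * heat t gap₁₁ y (v n s))
      + 2 * t * (0 + 0 + ∑ n, e n s * heat t gap₁₂ y (v n s))
      + (0 + T₂ y.2 s + ∑ n, e n s * heat t gap₂₂ y (v n s))
      + m / (1 + t) * ((T₁ y.1 s + 0 + ∑ n, e n s * heat t gap₁ y (v n s)) ^ 2
        + 2 * t * ((T₁ y.1 s + 0 + ∑ n, e n s * heat t gap₁ y (v n s))
          * (0 + T₁ y.2 s + ∑ n, e n s * heat t gap₂ y (v n s)))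
        + (0 + T₁ y.2 s + ∑ n, e n s * heat t gap₂ y (v n s)) ^ 2)) / 2 ≤
      (T₂ y.1 s + m * T₁ y.1 s ^ 2) / 2 + (T₂ y.2 s + m * T₁ y.2 s ^ 2) / 2
        + ∑ n, (q n * heat t gap y (v n s) + e n s * ((1 - deltaZero n) * (lap n / 2)))
    rw [s2]
    simp only [add_zero, zero_add]
    linarith only [main, s1]

end Coupling

/-! ### Transfer to an arbitrary Gaussian pair -/

lemma IsStdGaussianPair.logExpMean_eq {S : Type*} [MeasurableSpace S] {P : Measure S}
    {y₁ y₂ : S → ℝ} {t : ℝ} (h : IsStdGaussianPair P y₁ y₂ t) (ht0 : 0 ≤ t) {f : ℝ × ℝ → ℝ}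
    (hf : Continuous f) (a : ℝ) :
    logExpMean P a (fun s => f (y₁ s, y₂ s)) = logExpMean (gaussPair t) a f := by
  rw [logExpMean, logExpMean, h.integral_eq ht0 hf,
    h.integral_eq ht0 (f := fun p => Real.exp (a * f p)) (by fun_prop)]

lemma IsStdGaussianPair.tanhGap_eq {S : Type*} [MeasurableSpace S] {P : Measure S}
    {y₁ y₂ : S → ℝ} {t : ℝ} (h : IsStdGaussianPair P y₁ y₂ t) (ht0 : 0 ≤ t) (x₁ x₂ w : ℝ) :
    tanhGap P y₁ y₂ x₁ x₂ w = heat t gap (x₁, x₂) w := by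
  have hc := hasHess_gap.grad.continuous
  rw [heat, ← h.integral_eq ht0 (f := fun p => gap ((x₁, x₂) + Real.sqrt w • p)) (by fun_prop),
    tanhGap]
  simp [gap, mul_comm]

end

theorem mainTheorem8 (C₁ : ℝ) (hC₁ : 0 < C₁) (L : ℕ) :
    ∃ K₁ : ℝ,
      ∀ (m wmax : ℝ), 0 ≤ m → m ≤ 1 → 0 ≤ wmax →
      ∀ A : ℝ → ℝ, ConditionA m wmax C₁ A →
      ∀ (S : Type*) [MeasurableSpace S] (P : Measure S) [IsProbabilityMeasure P]
        (y₁ y₂ : S → ℝ) (t : ℝ), 0 ≤ t → IsStdGaussianPair P y₁ y₂ t →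
      ∀ (K : ℝ), 0 < K →
      ∀ (l : ℕ) (α : Fin (l + 1) → ℝ), (∀ n, 0 ≤ α n ∧ α n ≤ K) →
      ∃ C : Fin (l + 1) → ℝ,
        (∀ n, 0 < C n ∧ C n ≤ 4 * (∑ i, α i) + K₁) ∧
        ∀ (x₁ x₂ w : ℝ), 0 ≤ w → w ≤ min wmax (1 / (2 * C 0)) →
        ∀ wseq : Fin (l + 1) → ℝ, wseq 0 = 0 → (∀ n, 0 ≤ wseq n ∧ wseq n ≤ (L : ℝ)) →
          Integrable (coupledValue P y₁ y₂ A α wseq x₁ x₂ w) P ∧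
          Integrable
            (fun s => Real.exp (m / (1 + t) * coupledValue P y₁ y₂ A α wseq x₁ x₂ w s)) P ∧
          logExpMean P (m / (1 + t)) (coupledValue P y₁ y₂ A α wseq x₁ x₂ w)
            ≤ logExpMean P m (fun s => A (x₁ + y₁ s * Real.sqrt w))
              + logExpMean P m (fun s => A (x₂ + y₂ s * Real.sqrt w))
              - ∑ n, (α n * (1 - w * C n)
                    + (t / (2 * (1 + t) * C₁ ^ 2)) / 2 * m * w * deltaZero n)
                  * tanhGap P y₁ y₂ x₁ x₂ ((1 - deltaZero n) * w + wseq n) := by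
  refine ⟨couplingConst C₁ L, fun m wmax hm0 hm1 hwmax A hA S _ P _ y₁ y₂ t ht0 h K _ l α hα => ?_⟩
  have ht1 := h.le_one
  set C := 4 * (∑ n, α n) + couplingConst C₁ L with hC
  have hSα : 0 ≤ ∑ n, α n := Finset.sum_nonneg fun n _ => (hα n).1
  have hC0 : 0 < C := by linarith [two_le_couplingConst hC₁ L]
  -- All the constants can be taken equal to the upper bound allowed for them.
  refine ⟨fun _ => C, fun n => ⟨hC0, le_rfl⟩, fun x₁ x₂ w hw0 hw wseq hz hwseq => ?_⟩
  have hwC : w * C ≤ 1 / 2 := by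
    have := (le_div_iff₀ (by positivity)).1 (hw.trans (min_le_right _ _))
    linarith
  obtain ⟨hcont, ⟨B, hB, hb⟩, hle⟩ := couplingFlow_bound hA hC₁ hm0 hm1 ht0 ht1
    (fun n => (hα n).1) hC rfl hw0 (hw.trans (min_le_left _ _)) hwC hz hwseq
  set κ := t / (2 * (1 + t) * C₁ ^ 2) / 2 * m
  set Z : ℝ × ℝ → ℝ := fun p =>
    couplingFlow A m t C κ α wseq ((x₁, x₂) + Real.sqrt w • p) 0 with hZ
  have hZc : Continuous Z := by fun_prop
  have hZb : ∀ p, |Z p| ≤ B * (1 + ‖(x₁, x₂)‖) + B * Real.sqrt w * ‖p‖ := by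
    intro p
    refine (hb _).trans ?_
    have h1 := norm_add_le (x₁, x₂) (Real.sqrt w • p)
    rw [norm_smul, Real.norm_eq_abs, abs_of_nonneg (Real.sqrt_nonneg w)] at h1
    have := mul_le_mul_of_nonneg_left h1 hB
    linarith
  -- At time `0` the coefficients are `αₙ`, the clocks are `wₙ`, and `T` is `A`.
  have hval : coupledValue P y₁ y₂ A α wseq x₁ x₂ w = fun s => Z (y₁ s, y₂ s) := by
    ext s
    simp only [hZ, couplingFlow, coupledValue, smoothT_zero, h.tanhGap_eq ht0, sub_eq_add_neg,
      ← Finset.sum_neg_distrib]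
    simp [mul_comm]
  have hZg : ExpGrowth Z := by
    refine ((ExpGrowth.const (B * (1 + ‖(x₁, x₂)‖))).add
      (ExpGrowth.norm_id.const_mul (B * Real.sqrt w))).mono fun p => ?_
    exact (hZb p).trans (le_abs_self _)
  have ha : 0 ≤ m / (1 + t) := by positivity
  have hEg : ExpGrowth (fun p => Real.exp (m / (1 + t) * Z p)) := by
    refine ExpGrowth.exp ⟨m / (1 + t) * (B * (1 + ‖(x₁, x₂)‖)), m / (1 + t) * (B * Real.sqrt w),
      by positivity, fun p => ?_⟩
    have := mul_le_mul_of_nonneg_left ((le_abs_self _).trans (hZb p)) ha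
    linarith
  have hAc : Continuous A := by
    obtain ⟨_, _, dA, -⟩ := hA.exists_deriv hC₁ hwmax
    exact continuous_iff_continuousAt.2 fun x => (dA x).continuousAt
  have marginal : ∀ {y : S → ℝ}, AEMeasurable y P → P.map y = gaussianReal 0 1 → ∀ x,
      logExpMean P m (fun s => A (x + y s * Real.sqrt w)) = smoothT A m x w := by
    intro y hy hmap x
    rw [smoothT, ← hmap, logExpMean, logExpMean, integral_map hy (by fun_prop),
      integral_map hy (by fun_prop)]
  rw [hval]
  refine ⟨h.integrable_comp ht0 hZc hZg,
    h.integrable_comp ht0 (f := fun p => Real.exp (m / (1 + t) * Z p)) (by fun_prop) hEg, ?_⟩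
  rw [h.logExpMean_eq ht0 hZc, marginal h.gaussian.fst.aemeasurable h.map_fst.1,
    marginal h.gaussian.snd.aemeasurable h.map_fst.2]
  -- The value of the interpolation at time `w` is the stated right-hand side.
  refine (hle (x₁, x₂)).trans (le_of_eq ?_)
  simp only [couplingFlow, h.tanhGap_eq ht0, neg_mul, Finset.sum_neg_distrib, sub_eq_add_neg]
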